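/- Let $p,q\ge 1$, let $X=(X_1,\dots,X_p)$ and $Y=(Y_1,\dots,Y_q)$ be random vectors on a probability space $(\Omega,\mathcal A,P)$ such that no $Y_i$ is almost surely constant, and let $(\mathbf X_1,\mathbf Y_1),(\mathbf X_2,\mathbf Y_2),\dots$ be i.i.d. copies of $(X,Y)$ on this space. For a non-degenerate real random variable $U$ and a random vector $V$ put $$\xi(U|V)=\frac{\int_{\mathbb R}\operatorname{Var}\big(P(U\ge y\mid V)\big)\,dP^{U}(y)}{\int_{\mathbb R}\operatorname{Var}\big(\mathbf 1_{\{U\ge y\}}\big)\,dP^{U}(y)},$$ and, with the convention $\xi(Y_1|\emptyset)=0$, $$T(Y|X)=\frac{\sum_{i=1}^q\big[\xi(Y_i|(X,Y_{i-1},\dots,Y_1))-\xi(Y_i|(Y_{i-1},\dots,Y_1))\big]}{\sum_{i=1}^q\big[1-\xi(Y_i|(Y_{i-1},\dots,Y_1))\big]},\qquad \overline T(Y|X)=\frac1{q!}\sum_{\sigma\in S_q}T(Y_\sigma|X),$$ where $Y_\sigma=(Y_{\sigma_1},\dots,Y_{\sigma_q})$. Let $n\ge 2$. For a real component $U$ of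 $Y$ and a vector $V$ of components of $(X,Y)$, with sample values $(U_k,V_k)$, $k=1,\dots,n$, taken from $(\mathbf X_1,\mathbf Y_1),\dots,(\mathbf X_n,\mathbf Y_n)$, put $$\xi_n(U|V)=\frac{\sum_{k=1}^n\big(n\min\{R_k,R_{N(k)}\}-L_k^2\big)}{\sum_{k=1}^nL_k(n-L_k)},$$ where $R_k=\#\{l\le n:U_l\le U_k\}$, $L_k=\#\{l\le n:U_l\ge U_k\}$, and $N(k)$ is an index $l\neq k$ for which $V_l$ is a nearest neighbour of $V_k$ in the Euclidean metric, ties being broken at random: conditionally on the sample $(\mathbf X_1,\mathbf Y_1),\dots,(\mathbf X_n,\mathbf Y_n)$, the indices $N(1),\dots,N(n)$ are independent and each $N(k)$ is uniformly distributed on the set of all nearest-neighbour indices of $k$. (The joint distribution of the tie-breaking for different $n$ and for different predictor vectors $V$ is arbitrary.) Define $$T_n(Y|X)=1-\frac{q-\sum_{i=1}^q\xi_n(Y_i|(X,Y_{i-1},\dots,Y_1))}{q-\sum_{i=2}^q\xi_n(Y_i|(Y_{i-1},\dots,Y_1))},\qquad \overline T_n(Y|X)=\frac1{q!}\sum_{\sigma\in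 S_q}T_n(Y_\sigma|X).$$ (For small $n$ a denominator may vanish; a quotient with zero denominator is given the value $0$.) Then, as $n\to\infty$, $T_n(Y|X)\to T(Y|X)$ almost surely and $\overline T_n(Y|X)\to\overline T(Y|X)$ almost surely. -/

import Mathlib

open MeasureTheory ProbabilityTheory Filter Topology

noncomputable section

/-! ### The population quantities -/

/-- The Azadkia-Chatterjee coefficient
`ξ(Y | V) = ∫ Var(P(Y ≥ y | V)) dP^Y(y) / ∫ Var(1_{Y ≥ y}) dP^Y(y)`. -/
def acXi {Ω E : Type*} [MeasurableSpace Ω] [mE : MeasurableSpace E] (P : Measure Ω)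
    (Y : Ω → ℝ) (V : Ω → E) : ℝ :=
  (∫ y, variance (P[{ω | y ≤ Y ω}.indicator (fun _ => (1 : ℝ)) | mE.comap V]) P ∂(P.map Y)) /
    (∫ y, variance ({ω | y ≤ Y ω}.indicator (fun _ => (1 : ℝ))) P ∂(P.map Y))

/-- The vector `(Y_{i-1}, …, Y_1)` of the components preceding the `i`-th one. -/
def prevY {q : ℕ} (i : Fin q) (y : EuclideanSpace ℝ (Fin q)) :
    EuclideanSpace ℝ {j : Fin q // j < i} :=
  WithLp.toLp 2 (fun j => y j.1)

/-- The vector `(X, Y_{i-1}, …, Y_1)`, with the Euclidean structure of `ℝ^{p+i-1}`. -/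
def prevXY {p q : ℕ} (i : Fin q)
    (z : EuclideanSpace ℝ (Fin p) × EuclideanSpace ℝ (Fin q)) :
    EuclideanSpace ℝ (Fin p ⊕ {j : Fin q // j < i}) :=
  WithLp.toLp 2 (Sum.elim (fun a => z.1 a) (fun j => z.2 j.1))

/-- `ξ(Y_i | (Y_{i-1}, …, Y_1))`, with the convention `ξ(Y_1 | ∅) = 0`. -/
def acXiPrev {Ω : Type*} [MeasurableSpace Ω] (P : Measure Ω) {q : ℕ}
    (Y : Ω → EuclideanSpace ℝ (Fin q)) (i : Fin q) : ℝ :=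
  if i.val = 0 then 0 else acXi P (fun ω => Y ω i) (fun ω => prevY i (Y ω))

/-- The measure of predictability `T(Y | X)`. -/
def predT {Ω : Type*} [MeasurableSpace Ω] (P : Measure Ω) {p q : ℕ}
    (X : Ω → EuclideanSpace ℝ (Fin p)) (Y : Ω → EuclideanSpace ℝ (Fin q)) : ℝ :=
  (∑ i, (acXi P (fun ω => Y ω i) (fun ω => prevXY i (X ω, Y ω)) - acXiPrev P Y i)) /
    (∑ i, (1 - acXiPrev P Y i))

/-- The permuted vector `y_σ = (y_{σ_1}, …, y_{σ_q})`. -/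
def permVec {q : ℕ} (σ : Equiv.Perm (Fin q)) (y : EuclideanSpace ℝ (Fin q)) :
    EuclideanSpace ℝ (Fin q) :=
  WithLp.toLp 2 (fun j => y (σ j))

/-- The permutation-invariant version `T̄(Y | X)`. -/
def predTbar {Ω : Type*} [MeasurableSpace Ω] (P : Measure Ω) {p q : ℕ}
    (X : Ω → EuclideanSpace ℝ (Fin p)) (Y : Ω → EuclideanSpace ℝ (Fin q)) : ℝ :=
  (1 / (Nat.factorial q : ℝ)) *
    ∑ σ : Equiv.Perm (Fin q), predT P X (fun ω => permVec σ (Y ω))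

/-! ### The estimators -/

/-- `R_k`, the number of `l` with `y_l ≤ y_k`. -/
def rankLE {n : ℕ} (y : Fin n → ℝ) (k : Fin n) : ℕ :=
  (Finset.univ.filter (fun l => y l ≤ y k)).card

/-- `L_k`, the number of `l` with `y_l ≥ y_k`. -/
def rankGE {n : ℕ} (y : Fin n → ℝ) (k : Fin n) : ℕ :=
  (Finset.univ.filter (fun l => y k ≤ y l)).card

/-- The estimator `ξ_n`, as a function of the response sample `y_1, …, y_n` and of the selected
nearest neighbours `N(1), …, N(n)` of the predictor sample. -/
def acXiN {n : ℕ} (y : Fin n → ℝ) (N : Fin n → Fin n) : ℝ :=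
  (∑ k, ((n : ℝ) * min (rankLE y k : ℝ) (rankLE y (N k) : ℝ) - (rankGE y k : ℝ) ^ 2)) /
    (∑ k, (rankGE y k : ℝ) * ((n : ℝ) - (rankGE y k : ℝ)))

/-- The estimator `T_n`: `N i` is the nearest-neighbour selection for the predictors
`(X, Y_{i-1}, …, Y_1)` and `M i` the one for `(Y_{i-1}, …, Y_1)`. -/
def predTN {n q : ℕ} (y : Fin n → EuclideanSpace ℝ (Fin q))
    (N M : Fin q → Fin n → Fin n) : ℝ :=
  1 - ((q : ℝ) - ∑ i, acXiN (fun l => y l i) (N i)) /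
    ((q : ℝ) - ∑ i with 0 < i.val, acXiN (fun l => y l i) (M i))

/-- The permutation-averaged estimator `T̄_n`. -/
def predTbarN {n q : ℕ} (y : Fin n → EuclideanSpace ℝ (Fin q))
    (N M : Equiv.Perm (Fin q) → Fin q → Fin n → Fin n) : ℝ :=
  (1 / (Nat.factorial q : ℝ)) *
    ∑ σ : Equiv.Perm (Fin q), predTN (fun l => permVec σ (y l)) (N σ) (M σ)

/-! ### Nearest neighbours with ties broken at random -/

open scoped Classical in
/-- The indices `l ≠ k` for which `v l` has minimal distance to `v k`. -/
def nearestIdx {E : Type*} [PseudoMetricSpace E] {n : ℕ} (v : Fin n → E) (k : Fin n) :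
    Finset (Fin n) :=
  Finset.univ.filter (fun l => l ≠ k ∧ ∀ m, m ≠ k → dist (v k) (v l) ≤ dist (v k) (v m))

open scoped Classical in
/-- `N(k)` is a nearest neighbour of the `k`-th predictor value `g (Z k)`, ties being broken at
random: given the whole sample `Z_1, …, Z_n`, the variables `N(1), …, N(n)` are independent and
each `N(k)` is uniformly distributed on the set of all nearest-neighbour indices of `k`. -/
structure IsRandomNN {Ω D E : Type*} [MeasurableSpace Ω] [MeasurableSpace D]
    [PseudoMetricSpace E] (P : Measure Ω) {n : ℕ} (Z : Fin n → Ω → D) (g : D → E)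
    (N : Fin n → Ω → Fin n) : Prop where
  measurable : ∀ k, Measurable (N k)
  cond_law : ∀ j : Fin n → Fin n,
    P[{ω | ∀ k, N k ω = j k}.indicator (fun _ => (1 : ℝ)) |
        MeasurableSpace.comap (fun ω l => Z l ω) MeasurableSpace.pi]
      =ᵐ[P] fun ω => ∏ k,
        if j k ∈ nearestIdx (fun l => g (Z l ω)) k then
          (1 : ℝ) / ((nearestIdx (fun l => g (Z l ω)) k).card : ℝ)
        else 0

/-- The nearest-neighbour selections entering `T_n(Y | X)`, for all sample sizes `n ≥ 2`. Nothing is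
assumed on the joint behaviour of selections for different `n` or for different predictor
vectors. -/
structure IsRandomNNFamily {Ω : Type*} [MeasurableSpace Ω] (P : Measure Ω) {p q : ℕ}
    (Xs : ℕ → Ω → EuclideanSpace ℝ (Fin p)) (Ys : ℕ → Ω → EuclideanSpace ℝ (Fin q))
    (N M : Fin q → (n : ℕ) → Fin n → Ω → Fin n) : Prop where
  joint : ∀ i n, 2 ≤ n →
    IsRandomNN P (fun (l : Fin n) ω => (Xs l ω, Ys l ω)) (prevXY i) (N i n)
  prev : ∀ i : Fin q, 0 < i.val → ∀ n, 2 ≤ n →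
    IsRandomNN P (fun (l : Fin n) ω => (Xs l ω, Ys l ω)) (fun z => prevY i z.2) (M i n)

end

/-! After division by `n ^ 3`, the estimator `ξ_n` of a response `u` given a predictor `v` becomes a
quotient of averages of empirical distribution functions (`acXiN_eq`). Its numerator is the
fluctuation `nnDeviation` due to the random choice of neighbours, plus the tie-averaged statistic
`nnStat`, minus the second moment `rankStat 2` of the normalised upper ranks. Its denominator is
`rankStat 1 - rankStat 2`. Each of these quantities has an almost sure limit.

Fluctuations. Given the sample, the neighbours are chosen independently, so the conditional moment
generating function of `nnDeviation` factorises and is at most `exp (t ^ 2 / n)`. The statistics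
`nnStat` and `rankStat` change by `O(1 / n)` when one observation is changed, so McDiarmid's
inequality (`integral_exp_le_of_bounded_differences`) controls their deviation from the mean.
Borel–Cantelli then gives almost sure convergence (`ae_tendsto_zero_of_subgaussian`). It needs only
the law for each single `n`, so the coupling of the tie-breaking across sample sizes and predictors
plays no role. Bounded differences of `nnStat` rest on geometry: in finite dimension a point
receives bounded total weight as a neighbour of others (`exists_sum_nnWeight_le`). For coinciding
points this holds because ties share their weight.

Means. The empirical distribution function may be replaced by the true one, `F`, at cost `O(1 /
√n)`, and `F (min (u x) (u x'))` is the integral over thresholds `y`, distributed as `u`, of `1{y ≤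
u x} 1{y ≤ u x'}`. For fixed `y`, conditioning on the predictors turns the two indicators into `g y
(v x) * g y (v x')`, where `g y` is the conditional survival probability. A measurable function
takes close values at a point and at its neighbour on average (`tendsto_integral_nnAvg_abs_sub`), by
approximation with compactly supported continuous functions. The limit is therefore `∫ E[g y (V) ^
2] dP^U(y)`, with no continuity assumption on the laws.

With `G` the upper tail of `U`, the limit of `ξ_n` is `∫ (E[g y (V) ^ 2] - G y ^ 2) / ∫ (G y - G y ^
2)`, which is `ξ`; the denominator is positive for non-degenerate `U`. Finally `T_n` is a continuous
function of finitely many `ξ_n` near the limit: its denominator tends to a positive number, since `ξ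
≤ 1` and the first summand is `1` by convention. -/

/-! ### Averages over finite sets -/

/-- The average of `h` over `s`; it is `0` for empty `s`. -/
noncomputable def finAvg {α : Type*} (s : Finset α) (h : α → ℝ) : ℝ := (∑ l ∈ s, h l) / (s.card : ℝ)

lemma finAvg_nonneg {α : Type*} (s : Finset α) {h : α → ℝ} (h0 : ∀ l, 0 ≤ h l) : 0 ≤ finAvg s h :=
  div_nonneg (Finset.sum_nonneg fun l _ => h0 l) (Nat.cast_nonneg _)

lemma finAvg_le_one {α : Type*} (s : Finset α) {h : α → ℝ} (h1 : ∀ l, h l ≤ 1) :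
    finAvg s h ≤ 1 := by
  refine div_le_one_of_le₀ ?_ (Nat.cast_nonneg _)
  simpa using Finset.sum_le_sum fun l (_ : l ∈ s) => h1 l

lemma abs_finAvg_sub_le {α : Type*} (s : Finset α) {h h' : α → ℝ} {δ : ℝ} (hδ : 0 ≤ δ)
    (H : ∀ l ∈ s, |h l - h' l| ≤ δ) : |finAvg s h - finAvg s h'| ≤ δ := by
  unfold finAvg
  rw [← sub_div, ← Finset.sum_sub_distrib, abs_div, Nat.abs_cast]
  refine div_le_of_le_mul₀ (Nat.cast_nonneg _) hδ ?_
  calc _ ≤ ∑ l ∈ s, |h l - h' l| := Finset.abs_sum_le_sum_abs _ _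
    _ ≤ ∑ l ∈ s, δ := Finset.sum_le_sum H
    _ = δ * s.card := by simp [mul_comm]

/-- The bound `1 / s.card` is exactly the nearest-neighbour weight of `i` when `s` is the set of
neighbours. Hence deleting an observation disturbs a row by no more than the weight that the
observation had there. -/
lemma abs_finAvg_sub_erase_le {α : Type*} [DecidableEq α] {s : Finset α} {i : α} (hi : i ∈ s)
    {h : α → ℝ} (h0 : ∀ l, 0 ≤ h l) (h1 : ∀ l, h l ≤ 1) :
    |finAvg s h - finAvg (s.erase i) h| ≤ 1 / (s.card : ℝ) := by
  have hc : (s.card : ℝ) = ((s.erase i).card : ℝ) + 1 := by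
    exact_mod_cast (Finset.card_erase_add_one hi).symm
  have hs : ∑ l ∈ s, h l = ∑ l ∈ s.erase i, h l + h i := (Finset.sum_erase_add s h hi).symm
  have hS0 : 0 ≤ ∑ l ∈ s.erase i, h l := Finset.sum_nonneg fun l _ => h0 l
  have hS1 : ∑ l ∈ s.erase i, h l ≤ ((s.erase i).card : ℝ) := by
    simpa using Finset.sum_le_sum fun l (_ : l ∈ s.erase i) => h1 l
  unfold finAvg
  rw [hs, hc]
  generalize ∑ l ∈ s.erase i, h l = S at *
  rcases (s.erase i).card.eq_zero_or_pos with hm | hm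
  · rw [hm] at hS1 ⊢
    have : S = 0 := le_antisymm (by simpa using hS1) hS0
    rw [this, abs_le]
    constructor <;> norm_num <;> linarith [h0 i, h1 i]
  · have hm' : (0 : ℝ) < ((s.erase i).card : ℝ) := by exact_mod_cast hm
    generalize ((s.erase i).card : ℝ) = m at *
    have e : (S + h i) / (m + 1) - S / m = (m * h i - S) / (m * (m + 1)) := by
      field_simp; ring
    rw [e, abs_div, abs_of_pos (by positivity : 0 < m * (m + 1)), div_le_div_iff₀ (by positivity)
      (by positivity)]
    have : |m * h i - S| ≤ m := by
      rw [abs_le]; constructor <;> nlinarith [h0 i, h1 i]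
    nlinarith

/-! ### Nearest-neighbour weights -/

open scoped Classical in
/-- The conditional probability that `l` is selected as the nearest neighbour of `k`. -/
noncomputable def nnWeight {E : Type*} [PseudoMetricSpace E] {n : ℕ} (v : Fin n → E)
    (k l : Fin n) : ℝ :=
  if l ∈ nearestIdx v k then (1 : ℝ) / ((nearestIdx v k).card : ℝ) else 0

section Weights
variable {E : Type*} [PseudoMetricSpace E] {n : ℕ}

lemma mem_nearestIdx {v : Fin n → E} {k l : Fin n} :
    l ∈ nearestIdx v k ↔ l ≠ k ∧ ∀ m, m ≠ k → dist (v k) (v l) ≤ dist (v k) (v m) := by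
  simp [nearestIdx]

lemma nnWeight_nonneg (v : Fin n → E) (k l : Fin n) : 0 ≤ nnWeight v k l := by
  unfold nnWeight; split_ifs <;> positivity

lemma nnWeight_self (v : Fin n → E) (k : Fin n) : nnWeight v k k = 0 := by
  simp [nnWeight, mem_nearestIdx]

lemma sum_nnWeight_mul (v : Fin n → E) (k : Fin n) (h : Fin n → ℝ) :
    ∑ l, nnWeight v k l * h l = finAvg (nearestIdx v k) h := by
  classical
  unfold nnWeight finAvg
  simp only [ite_mul, zero_mul, Finset.sum_ite_mem, Finset.univ_inter]
  rw [Finset.sum_div]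
  exact Finset.sum_congr rfl fun l _ => by ring

lemma nearestIdx_nonempty (hn : 2 ≤ n) (v : Fin n → E) (k : Fin n) :
    (nearestIdx v k).Nonempty := by
  have : Nontrivial (Fin n) := Fin.nontrivial_iff_two_le.2 hn
  obtain ⟨l₀, hl₀⟩ := exists_ne k
  obtain ⟨l, hl, h⟩ := (Finset.univ.erase k).exists_min_image (fun l => dist (v k) (v l))
    ⟨l₀, by simp [hl₀]⟩
  exact ⟨l, mem_nearestIdx.2 ⟨by simpa using hl, fun m hm => h m (by simp [hm])⟩⟩

lemma sum_nnWeight (hn : 2 ≤ n) (v : Fin n → E) (k : Fin n) : ∑ l, nnWeight v k l = 1 := by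
  have := sum_nnWeight_mul v k (fun _ => 1)
  simp only [mul_one] at this
  rw [this, finAvg]
  have : ((nearestIdx v k).card : ℝ) ≠ 0 := by
    exact_mod_cast (Finset.card_pos.2 (nearestIdx_nonempty hn v k)).ne'
  simp [this]

lemma sum_nnWeight_le_one (v : Fin n → E) (k : Fin n) : ∑ l, nnWeight v k l ≤ 1 := by
  have := sum_nnWeight_mul v k (fun _ => 1)
  simp only [mul_one] at this
  rw [this]
  exact finAvg_le_one _ fun _ => le_rfl

lemma nnWeight_le_one (v : Fin n → E) (k l : Fin n) : nnWeight v k l ≤ 1 :=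
  (Finset.single_le_sum (fun l _ => nnWeight_nonneg v k l) (Finset.mem_univ l)).trans
    (sum_nnWeight_le_one v k)

open scoped Classical in
/-- Up to the weight of `i`, the nearest-neighbour average at `k ≠ i` depends only on the points
other than the `i`-th one. -/
lemma abs_finAvg_nearestIdx_sub_le (v : Fin n → E) {k i : Fin n} (hki : k ≠ i) {h : Fin n → ℝ}
    (h0 : ∀ l, 0 ≤ h l) (h1 : ∀ l, h l ≤ 1) :
    |finAvg (nearestIdx v k) h - finAvg (Finset.univ.filter fun l => (l ≠ k ∧ l ≠ i) ∧
        ((∀ m, m ≠ k → m ≠ i → dist (v k) (v l) ≤ dist (v k) (v m)))) h|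
      ≤ nnWeight v k i ∨ nnWeight v k i = 1 := by
  set s := Finset.univ.filter fun l => (l ≠ k ∧ l ≠ i) ∧
        ((∀ m, m ≠ k → m ≠ i → dist (v k) (v l) ≤ dist (v k) (v m))) with hs
  have hsub : ∀ l, l ∈ nearestIdx v k → l ≠ i → l ∈ s := by
    intro l hl hli
    rw [mem_nearestIdx] at hl
    simp only [hs, Finset.mem_filter, Finset.mem_univ, true_and]
    exact ⟨⟨hl.1, hli⟩, fun m hm _ => hl.2 m hm⟩
  have hsup : ∀ l₀, l₀ ∈ nearestIdx v k → l₀ ≠ i → ∀ l ∈ s, l ∈ nearestIdx v k := by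
    intro l₀ hl₀ hli l hl
    rw [mem_nearestIdx] at hl₀ ⊢
    simp only [hs, Finset.mem_filter, Finset.mem_univ, true_and] at hl
    exact ⟨hl.1.1, fun m hm => (hl.2 l₀ hl₀.1 hli).trans (hl₀.2 m hm)⟩
  by_cases hi : i ∈ nearestIdx v k
  · have hw : nnWeight v k i = 1 / ((nearestIdx v k).card : ℝ) := by simp [nnWeight, hi]
    -- If `i` is the only neighbour, deleting it brings in entirely new neighbours and no comparison
    -- is possible; this is the alternative of weight one. Otherwise the minimal distance is still
    -- attained, and only `i` drops out of the set.
    rcases ((nearestIdx v k).erase i).eq_empty_or_nonempty with he | ⟨l₀, hl₀⟩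
    · right
      have : (nearestIdx v k).card = 1 := by
        rw [← Finset.card_erase_add_one hi, he]; rfl
      rw [hw, this]; norm_num
    · left
      rw [Finset.mem_erase] at hl₀
      have : s = (nearestIdx v k).erase i := by
        ext l
        rw [Finset.mem_erase]
        refine ⟨fun hl => ⟨?_, hsup l₀ hl₀.2 hl₀.1 l hl⟩, fun hl => hsub l hl.2 hl.1⟩
        simp only [hs, Finset.mem_filter] at hl
        exact hl.2.1.2
      rw [this, hw]
      convert abs_finAvg_sub_erase_le hi h0 h1
  · left
    have : s = nearestIdx v k := by
      ext l
      refine ⟨fun hl => ?_, fun hl => hsub l hl fun e => hi (e ▸ hl)⟩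
      have hne : (nearestIdx v k).Nonempty := by
        refine nearestIdx_nonempty ?_ v k
        have := k.2; have := i.2
        have : (k : ℕ) ≠ i := fun e => hki (Fin.ext e)
        omega
      obtain ⟨l₀, hl₀⟩ := hne
      exact hsup l₀ hl₀ (fun e => hi (e ▸ hl₀)) l hl
    rw [this]
    simpa using nnWeight_nonneg v k i

/-- Both averages are compared with the average over the neighbours of `k` in the sample without
`i`, a set that is the same for `v` and `v'`. When `i` has weight one in either sample, the right
side is at least `1` and the bound is trivial. -/
lemma abs_nnAvg_sub_le {v v' : Fin n → E} {i k : Fin n} (hki : k ≠ i)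
    (hv : ∀ l, l ≠ i → v' l = v l) {h h' : Fin n → ℝ} {δ : ℝ} (hδ : 0 ≤ δ)
    (h0 : ∀ l, 0 ≤ h l) (h1 : ∀ l, h l ≤ 1) (h0' : ∀ l, 0 ≤ h' l) (h1' : ∀ l, h' l ≤ 1)
    (hh : ∀ l, l ≠ i → |h' l - h l| ≤ δ) :
    |∑ l, nnWeight v' k l * h' l - ∑ l, nnWeight v k l * h l|
      ≤ nnWeight v k i + nnWeight v' k i + δ := by
  classical
  rw [sum_nnWeight_mul, sum_nnWeight_mul]
  have b0 := finAvg_nonneg (nearestIdx v k) h0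
  have b1 := finAvg_le_one (nearestIdx v k) h1
  have b0' := finAvg_nonneg (nearestIdx v' k) h0'
  have b1' := finAvg_le_one (nearestIdx v' k) h1'
  have w0 := nnWeight_nonneg v k i
  have w0' := nnWeight_nonneg v' k i
  have triv : |finAvg (nearestIdx v' k) h' - finAvg (nearestIdx v k) h| ≤ 1 :=
    abs_le.2 ⟨by linarith, by linarith⟩
  rcases abs_finAvg_nearestIdx_sub_le v hki h0 h1 with A | A
  swap
  · linarith
  rcases abs_finAvg_nearestIdx_sub_le v' hki h0' h1' with B | B
  swap
  · linarith
  set s := Finset.univ.filter fun l => (l ≠ k ∧ l ≠ i) ∧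
        ((∀ m, m ≠ k → m ≠ i → dist (v k) (v l) ≤ dist (v k) (v m))) with hs
  have e : (Finset.univ.filter fun l => (l ≠ k ∧ l ≠ i) ∧
        ((∀ m, m ≠ k → m ≠ i → dist (v' k) (v' l) ≤ dist (v' k) (v' m)))) = s := by
    ext l
    simp only [hs, Finset.mem_filter, Finset.mem_univ, true_and]
    refine and_congr_right fun hl => forall_congr' fun m => ?_
    refine forall_congr' fun _ => forall_congr' fun hm => ?_
    rw [hv k hki, hv l hl.2, hv m hm]
  rw [e] at B
  have C : |finAvg s h' - finAvg s h| ≤ δ := by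
    refine abs_finAvg_sub_le s hδ fun l hl => hh l ?_
    simp only [hs, Finset.mem_filter] at hl
    exact hl.2.1.2
  rw [abs_le] at A B C ⊢
  constructor <;> linarith [A.1, A.2, B.1, B.2, C.1, C.2]

end Weights

/-! ### Geometry of nearest neighbours in finite dimension -/

section Geometry
variable {E : Type*} [NormedAddCommGroup E] [ProperSpace E]

open scoped Classical in
/-- In a proper normed space, a point is a nearest neighbour of a bounded number of points different
from it. -/
lemma exists_card_nearestIdx_le [NormedSpace ℝ E] : ∃ K : ℕ, ∀ (n : ℕ) (v : Fin n → E) (i : Fin n),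
    (Finset.univ.filter fun k => v k ≠ v i ∧ i ∈ nearestIdx v k).card ≤ K := by
  obtain ⟨t, -, ht, hcov⟩ := finite_cover_balls_of_compact (isCompact_sphere (0 : E) 1)
    (show (0 : ℝ) < 1 / 2 by norm_num)
  refine ⟨ht.toFinset.card, fun n v i => ?_⟩
  set u : Fin n → E := fun k => ‖v k - v i‖⁻¹ • (v k - v i) with hu
  have hc : ∀ k, v k ≠ v i → ∃ c ∈ t, dist (u k) c < 1 / 2 := by
    intro k hk
    have : u k ∈ Metric.sphere (0 : E) 1 := by
      have : ‖v k - v i‖ ≠ 0 := norm_ne_zero_iff.2 (sub_ne_zero.2 hk)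
      simp [hu, norm_smul, this]
    simpa using hcov this
  choose! c hct hcd using hc
  refine Finset.card_le_card_of_injOn c (fun k hk => ?_) ?_
  · simp only [Finset.coe_filter, Set.mem_ofPred_eq] at hk
    simpa using hct k hk.2.1
  -- Seen from `v i`, two points assigned to the same small ball of directions have unit directions
  -- less than `1` apart. The farther one, `k'`, is then strictly closer to `v k` than to `v i`, so
  -- `i` cannot be its nearest neighbour. The number of such points is thus at most the number of
  -- balls covering the unit sphere.
  have key : ∀ k k', v k ≠ v i → v k' ≠ v i → i ∈ nearestIdx v k' → c k = c k' →
      ‖v k - v i‖ ≤ ‖v k' - v i‖ → k = k' := by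
    intro k k' hk hk' hi hcc hle
    by_contra hne
    have h1 := (mem_nearestIdx.1 hi).2 k hne
    have hr : 0 < ‖v k - v i‖ := norm_pos_iff.2 (sub_ne_zero.2 hk)
    have hs : 0 < ‖v k' - v i‖ := norm_pos_iff.2 (sub_ne_zero.2 hk')
    have hd : ‖u k' - u k‖ < 1 := by
      rw [← dist_eq_norm]
      calc dist (u k') (u k) ≤ dist (u k') (c k') + dist (c k') (u k) := dist_triangle _ _ _
        _ < 1 / 2 + 1 / 2 := by
          refine add_lt_add (hcd k' hk') ?_
          rw [← hcc, dist_comm]; exact hcd k hk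
        _ = 1 := by norm_num
    have hu1 : ‖u k'‖ = 1 := by simp [hu, norm_smul, hs.ne']
    have e : v k' - v k = ‖v k - v i‖ • (u k' - u k) + (‖v k' - v i‖ - ‖v k - v i‖) • u k' := by
      have e1 : ‖v k - v i‖ • u k = v k - v i := by simp [hu, smul_smul, hr.ne']
      have e2 : ‖v k' - v i‖ • u k' = v k' - v i := by simp [hu, smul_smul, hs.ne']
      rw [smul_sub, sub_smul, e1, e2]; abel
    rw [dist_eq_norm, dist_eq_norm, e] at h1
    have h2 : ‖‖v k - v i‖ • (u k' - u k) + (‖v k' - v i‖ - ‖v k - v i‖) • u k'‖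
        ≤ ‖v k - v i‖ * ‖u k' - u k‖ + (‖v k' - v i‖ - ‖v k - v i‖) := by
      refine (norm_add_le _ _).trans ?_
      rw [norm_smul, norm_smul, hu1, Real.norm_of_nonneg hr.le,
        Real.norm_of_nonneg (sub_nonneg.2 hle), mul_one]
    nlinarith
  intro k hk k' hk' hcc
  simp only [Finset.coe_filter, Set.mem_ofPred_eq] at hk hk'
  rcases le_total ‖v k - v i‖ ‖v k' - v i‖ with h | h
  · exact key k k' hk.2.1 hk'.2.1 hk'.2.2 hcc h
  · exact (key k' k hk'.2.1 hk.2.1 hk.2.2 hcc.symm h).symm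

/-- The total weight that a point receives as a nearest neighbour is bounded. -/
lemma exists_sum_nnWeight_le (E : Type*) [NormedAddCommGroup E] [NormedSpace ℝ E] [ProperSpace E] :
    ∃ K : ℝ, 0 ≤ K ∧ ∀ (n : ℕ) (v : Fin n → E) (i : Fin n), ∑ k, nnWeight v k i ≤ K := by
  classical
  obtain ⟨K, hK⟩ := exists_card_nearestIdx_le (E := E)
  refine ⟨K + 1, by positivity, fun n v i => ?_⟩
  set s := Finset.univ.filter fun k => k ≠ i ∧ v k = v i with hs
  -- Points away from `v i` contribute at most `1` each and are boundedly many. The points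
  -- coinciding with `v i` may be arbitrarily many, but each spreads its weight over at least
  -- `s.card` neighbours, so together they contribute at most `1`.
  have hpt : ∀ k, nnWeight v k i ≤ (if v k ≠ v i ∧ i ∈ nearestIdx v k then (1 : ℝ) else 0)
      + (if k ∈ s then 1 / (s.card : ℝ) else 0) := by
    intro k
    by_cases hi : i ∈ nearestIdx v k
    swap
    · have : nnWeight v k i = 0 := by simp [nnWeight, hi]
      rw [this]; positivity
    by_cases hk : v k = v i
    · have hks : k ∈ s := by
        simp only [hs, Finset.mem_filter, Finset.mem_univ, true_and]
        exact ⟨(mem_nearestIdx.1 hi).1.symm, hk⟩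
      have hcard : s.card ≤ (nearestIdx v k).card := by
        have hki : k ≠ i := (mem_nearestIdx.1 hi).1.symm
        -- The set `s` contains `k` and not `i`, while the neighbours of `k` include `i` and not
        -- `k`; the swap corrects this and otherwise fixes the coinciding points.
        refine Finset.card_le_card_of_injOn (Equiv.swap k i) (fun l hl => ?_)
          (Equiv.injective _).injOn
        simp only [hs, Finset.coe_filter, Finset.mem_univ, true_and, Set.mem_ofPred_eq] at hl
        have hz : ∀ l', v l' = v i → l' ≠ k → l' ∈ (nearestIdx v k : Set (Fin n)) := by
          intro l' h1 h2
          rw [Finset.mem_coe, mem_nearestIdx]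
          refine ⟨h2, fun m _ => ?_⟩
          rw [hk, h1, dist_self]; exact dist_nonneg
        by_cases hlk : l = k
        · rw [hlk, Equiv.swap_apply_left]; exact hz i rfl hki.symm
        · rw [Equiv.swap_apply_of_ne_of_ne hlk hl.1]; exact hz l hl.2 hlk
      have hpos : (0 : ℝ) < s.card := by exact_mod_cast Finset.card_pos.2 ⟨k, hks⟩
      have : nnWeight v k i ≤ 1 / (s.card : ℝ) := by
        simp only [nnWeight, hi, if_true]
        exact one_div_le_one_div_of_le hpos (by exact_mod_cast hcard)
      simpa [hks, hk] using this
    · have : nnWeight v k i ≤ 1 := nnWeight_le_one v k i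
      have h2 : (0 : ℝ) ≤ (if k ∈ s then 1 / (s.card : ℝ) else 0) := by positivity
      simp only [ne_eq, hk, not_false_eq_true, hi, and_self, if_true]
      linarith
  calc ∑ k, nnWeight v k i ≤ _ := Finset.sum_le_sum fun k _ => hpt k
    _ = ((Finset.univ.filter fun k => v k ≠ v i ∧ i ∈ nearestIdx v k).card : ℝ)
        + (s.card : ℝ) * (1 / (s.card : ℝ)) := by
      rw [Finset.sum_add_distrib]
      congr 1
      · rw [Finset.sum_boole]
      · rw [Finset.sum_ite_mem, Finset.univ_inter, Finset.sum_const, nsmul_eq_mul]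
    _ ≤ K + 1 := by
      refine add_le_add (by exact_mod_cast hK n v i) ?_
      rw [mul_one_div]
      exact div_self_le_one _

/-- All but a bounded number of the points in a ball have a nearest neighbour at distance at most
`δ`. -/
lemma exists_card_isolated_le (R : ℝ) {δ : ℝ} (hδ : 0 < δ) : ∃ M : ℕ, ∀ (n : ℕ) (v : Fin n → E)
    (s : Finset (Fin n)), (∀ k ∈ s, ‖v k‖ ≤ R ∧ ∃ l ∈ nearestIdx v k, δ ≤ dist (v k) (v l)) →
    s.card ≤ M := by
  obtain ⟨t, -, ht, hcov⟩ := finite_cover_balls_of_compact (isCompact_closedBall (0 : E) R)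
    (half_pos hδ)
  refine ⟨ht.toFinset.card, fun n v s hs => ?_⟩
  have hc : ∀ k ∈ s, ∃ c ∈ t, dist (v k) c < δ / 2 := by
    intro k hk
    have : v k ∈ Metric.closedBall (0 : E) R := by simpa using (hs k hk).1
    simpa using hcov this
  choose! c hct hcd using hc
  -- Two such points in one ball of radius `δ / 2` would be less than `δ` apart, against the
  -- distance `δ` to a nearest neighbour. Hence each covering ball holds at most one.
  refine Finset.card_le_card_of_injOn c (fun k hk => by simpa using hct k hk) ?_
  intro k hk k' hk' hcc
  by_contra hne
  obtain ⟨l, hl, hd⟩ := (hs k hk).2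
  have h1 := (mem_nearestIdx.1 hl).2 k' (Ne.symm hne)
  have h2 := dist_triangle (v k) (c k) (v k')
  have h3 := hcd k hk
  have h4 := hcd k' hk'
  rw [← hcc, dist_comm] at h4
  linarith

end Geometry

/-! ### Normalised ranks -/

/-- The empirical distribution function of `y` at `x`. -/
noncomputable def ecdf {n : ℕ} (y : Fin n → ℝ) (x : ℝ) : ℝ :=
  ((Finset.univ.filter fun l => y l ≤ x).card : ℝ) / n

section Ranks
variable {n : ℕ}

lemma ecdf_nonneg (y : Fin n → ℝ) (x : ℝ) : 0 ≤ ecdf y x := by unfold ecdf; positivity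

lemma ecdf_le_one (y : Fin n → ℝ) (x : ℝ) : ecdf y x ≤ 1 := by
  unfold ecdf
  refine div_le_one_of_le₀ ?_ (Nat.cast_nonneg _)
  exact_mod_cast (Finset.card_le_univ _).trans (by simp)

lemma ecdf_mono (y : Fin n → ℝ) : Monotone (ecdf y) := by
  intro a b hab
  unfold ecdf
  gcongr

lemma ecdf_eq_sum (y : Fin n → ℝ) (x : ℝ) :
    ecdf y x = (∑ l, if y l ≤ x then (1 : ℝ) else 0) / n := by
  simp [ecdf]

lemma abs_ecdf_sub_le {y y' : Fin n → ℝ} {i : Fin n} (h : ∀ l, l ≠ i → y' l = y l) (x : ℝ) :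
    |ecdf y' x - ecdf y x| ≤ 1 / n := by
  rw [ecdf_eq_sum, ecdf_eq_sum, ← sub_div, ← Finset.sum_sub_distrib, abs_div, Nat.abs_cast]
  refine div_le_div_of_nonneg_right ?_ (Nat.cast_nonneg _)
  rw [Finset.sum_eq_single i (fun l _ hl => by rw [h l hl, sub_self]) (by simp)]
  split_ifs <;> norm_num

lemma rankLE_div (y : Fin n → ℝ) (k : Fin n) : (rankLE y k : ℝ) / n = ecdf y (y k) := rfl

/-- Reflection turns upper ranks into lower ranks, so that everything is expressed by `ecdf` alone.
-/
lemma rankGE_div (y : Fin n → ℝ) (k : Fin n) :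
    (rankGE y k : ℝ) / n = ecdf (fun l => -y l) (-y k) := by
  simp [rankGE, ecdf]

/-- A monotone function commutes with `min`. This makes the summand an empirical distribution
function at a sample point, which can be linearised by indicators in the limit. -/
lemma min_rankLE_div (y : Fin n → ℝ) (k l : Fin n) :
    min (rankLE y k : ℝ) (rankLE y l : ℝ) / n = ecdf y (min (y k) (y l)) := by
  rw [(ecdf_mono y).map_min, ← rankLE_div, ← rankLE_div, min_div_div_right (Nat.cast_nonneg n)]

end Ranks

/-- The nearest-neighbour statistic, averaged over the random choice of the neighbours. -/
noncomputable def nnStat {E : Type*} [PseudoMetricSpace E] {n : ℕ} (v : Fin n → E)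
    (y : Fin n → ℝ) : ℝ :=
  (∑ k, ∑ l, nnWeight v k l * ecdf y (min (y k) (y l))) / n

/-- The empirical `j`-th moment of the normalised ranks. -/
noncomputable def rankStat {n : ℕ} (j : ℕ) (y : Fin n → ℝ) : ℝ := (∑ k, ecdf y (y k) ^ j) / n

/-! ### Effect of changing one observation -/

section BoundedDifferences
variable {n : ℕ}

lemma nnStat_nonneg {E : Type*} [PseudoMetricSpace E] (v : Fin n → E) (y : Fin n → ℝ) :
    0 ≤ nnStat v y :=
  div_nonneg (Finset.sum_nonneg fun _ _ => Finset.sum_nonneg fun _ _ =>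
    mul_nonneg (nnWeight_nonneg _ _ _) (ecdf_nonneg _ _)) (Nat.cast_nonneg _)

lemma nnStat_le_one {E : Type*} [PseudoMetricSpace E] (v : Fin n → E) (y : Fin n → ℝ) :
    nnStat v y ≤ 1 := by
  refine div_le_one_of_le₀ ?_ (Nat.cast_nonneg _)
  calc _ ≤ ∑ _k : Fin n, (1 : ℝ) := Finset.sum_le_sum fun k _ => by
        rw [sum_nnWeight_mul]; exact finAvg_le_one _ fun _ => ecdf_le_one _ _
    _ = n := by simp

lemma rankStat_nonneg (j : ℕ) (y : Fin n → ℝ) : 0 ≤ rankStat j y :=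
  div_nonneg (Finset.sum_nonneg fun _ _ => pow_nonneg (ecdf_nonneg _ _) _) (Nat.cast_nonneg _)

lemma rankStat_le_one (j : ℕ) (y : Fin n → ℝ) : rankStat j y ≤ 1 := by
  refine div_le_one_of_le₀ ?_ (Nat.cast_nonneg _)
  calc _ ≤ ∑ _k : Fin n, (1 : ℝ) := Finset.sum_le_sum fun k _ =>
        pow_le_one₀ (ecdf_nonneg _ _) (ecdf_le_one _ _)
    _ = n := by simp

/-- A sum of differences is bounded as soon as all terms but one are small. -/
lemma abs_sum_div_sub_le {a b d : Fin n → ℝ} {i : Fin n} {D : ℝ} (hi : |a i - b i| ≤ 1)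
    (hd : ∀ k, 0 ≤ d k) (h : ∀ k, k ≠ i → |a k - b k| ≤ d k) (hD : ∑ k, d k ≤ D) :
    |(∑ k, a k) / n - (∑ k, b k) / n| ≤ (D + 1) / n := by
  rw [← sub_div, ← Finset.sum_sub_distrib, abs_div, Nat.abs_cast]
  refine div_le_div_of_nonneg_right ?_ (Nat.cast_nonneg _)
  calc |∑ k, (a k - b k)| ≤ ∑ k, |a k - b k| := Finset.abs_sum_le_sum_abs _ _
    _ ≤ ∑ k, (d k + if k = i then 1 else 0) := Finset.sum_le_sum fun k _ => by
        split_ifs with hk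
        · subst hk; linarith [hd k]
        · simpa using h k hk
    _ ≤ D + 1 := by
      rw [Finset.sum_add_distrib]; simpa using hD

/-- The constant collects four contributions: `1` from row `i` itself, `K` from the weight of `i` in
the other rows before and again after the change, and `1` from the shift of at most `1 / n` of the
empirical distribution function in each of the `n` rows. -/
lemma abs_nnStat_sub_le {E : Type*} [PseudoMetricSpace E] {K : ℝ}
    (hK : ∀ (v : Fin n → E) (i : Fin n), ∑ k, nnWeight v k i ≤ K)
    {v v' : Fin n → E} {y y' : Fin n → ℝ} {i : Fin n}
    (hv : ∀ l, l ≠ i → v' l = v l) (hy : ∀ l, l ≠ i → y' l = y l) :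
    |nnStat v' y' - nnStat v y| ≤ (2 * K + 2) / n := by
  have hn : (0 : ℝ) < n := by exact_mod_cast (Fin.pos i)
  have e : 2 * K + 2 = (2 * K + 1) + 1 := by ring
  rw [e]
  refine abs_sum_div_sub_le (i := i) (d := fun k => nnWeight v k i + nnWeight v' k i + 1 / n)
    ?_ (fun k => ?_) (fun k hk => ?_) ?_
  · rw [sum_nnWeight_mul, sum_nnWeight_mul, abs_le]
    constructor <;> linarith [finAvg_nonneg (nearestIdx v i) fun l => ecdf_nonneg y (min (y i) (y l)),
      finAvg_le_one (nearestIdx v i) fun l => ecdf_le_one y (min (y i) (y l)),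
      finAvg_nonneg (nearestIdx v' i) fun l => ecdf_nonneg y' (min (y' i) (y' l)),
      finAvg_le_one (nearestIdx v' i) fun l => ecdf_le_one y' (min (y' i) (y' l))]
  · have := nnWeight_nonneg v k i
    have := nnWeight_nonneg v' k i
    positivity
  · refine abs_nnAvg_sub_le hk hv (by positivity) (fun _ => ecdf_nonneg _ _)
      (fun _ => ecdf_le_one _ _) (fun _ => ecdf_nonneg _ _) (fun _ => ecdf_le_one _ _) ?_
    intro l hl
    rw [hy k hk, hy l hl]
    exact abs_ecdf_sub_le hy _
  · rw [Finset.sum_add_distrib, Finset.sum_add_distrib]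
    have : ∑ _k : Fin n, 1 / (n : ℝ) = 1 := by simp [hn.ne']
    linarith [hK v i, hK v' i]

lemma abs_pow_sub_pow_le_mul {a b : ℝ} (ha : 0 ≤ a) (ha1 : a ≤ 1) (hb : 0 ≤ b) (hb1 : b ≤ 1)
    (j : ℕ) : |a ^ j - b ^ j| ≤ j * |a - b| := by
  refine (abs_pow_sub_pow_le a b j).trans ?_
  have : max |a| |b| ^ (j - 1) ≤ 1 :=
    pow_le_one₀ (by positivity) (by rw [abs_of_nonneg ha, abs_of_nonneg hb]; exact max_le ha1 hb1)
  calc |a - b| * j * max |a| |b| ^ (j - 1) ≤ |a - b| * j * 1 := by gcongr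
    _ = j * |a - b| := by ring

lemma abs_rankStat_sub_le (j : ℕ) {y y' : Fin n → ℝ} {i : Fin n}
    (hy : ∀ l, l ≠ i → y' l = y l) : |rankStat j y' - rankStat j y| ≤ (j + 1) / n := by
  have hn : (0 : ℝ) < n := by exact_mod_cast (Fin.pos i)
  refine abs_sum_div_sub_le (i := i) (d := fun _ => j * (1 / n)) ?_ (fun k => by positivity)
    (fun k hk => ?_) ?_
  · have h1 := pow_nonneg (ecdf_nonneg y (y i)) j
    have h2 := pow_nonneg (ecdf_nonneg y' (y' i)) j
    have h3 := pow_le_one₀ (n := j) (ecdf_nonneg y (y i)) (ecdf_le_one _ _)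
    have h4 := pow_le_one₀ (n := j) (ecdf_nonneg y' (y' i)) (ecdf_le_one _ _)
    rw [abs_le]; constructor <;> linarith
  · refine (abs_pow_sub_pow_le_mul (ecdf_nonneg _ _) (ecdf_le_one _ _) (ecdf_nonneg _ _)
      (ecdf_le_one _ _) j).trans ?_
    rw [hy k hk]
    gcongr
    exact abs_ecdf_sub_le hy _
  · have : (n : ℝ) * (j * (1 / n)) = j := by field_simp
    simpa using this.le

end BoundedDifferences

/-! ### Concentration -/

/-- For a centred bounded variable the linear term integrates to zero, which yields a sub-Gaussian
bound directly. The constant is not the optimal one of Hoeffding's lemma, but any constant suffices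
here. -/
lemma Real.exp_le_add_exp_sq (x : ℝ) : Real.exp x ≤ x + Real.exp (x ^ 2) := by
  by_cases h : |x| ≤ 1
  · have h1 := (abs_le.1 (Real.abs_exp_sub_one_sub_id_le h)).2
    have h2 := Real.add_one_le_exp (x ^ 2)
    linarith
  · rw [not_le, lt_abs] at h
    rcases h with h | h
    · have : Real.exp x ≤ Real.exp (x ^ 2) := Real.exp_le_exp.2 (by nlinarith)
      linarith
    · have h1 : Real.exp x ≤ 1 := Real.exp_le_one_iff.2 (by linarith)
      have h2 := Real.add_one_le_exp (x ^ 2)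
      nlinarith

section Concentration
variable {D : Type*} [MeasurableSpace D]

lemma integrable_of_abs_le {μ : Measure D} [IsFiniteMeasure μ] {f : D → ℝ} (hf : Measurable f)
    {B : ℝ} (hB : ∀ z, |f z| ≤ B) : Integrable f μ :=
  Integrable.of_bound hf.aestronglyMeasurable B (ae_of_all _ hB)

lemma integral_exp_mul_sub_integral_le (μ : Measure D) [IsProbabilityMeasure μ] {f : D → ℝ}
    (hf : Measurable f) {B c : ℝ} (hB : ∀ z, |f z| ≤ B) (hc : ∀ x y, |f x - f y| ≤ c) (t : ℝ) :
    ∫ x, Real.exp (t * (f x - ∫ y, f y ∂μ)) ∂μ ≤ Real.exp (t ^ 2 * c ^ 2) := by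
  have hi : Integrable f μ := integrable_of_abs_le hf hB
  have hd : ∀ x, |f x - ∫ y, f y ∂μ| ≤ c := by
    intro x
    have : f x - ∫ y, f y ∂μ = ∫ y, (f x - f y) ∂μ := by
      rw [integral_sub (integrable_const _) hi]; simp
    rw [this]
    refine (abs_integral_le_integral_abs).trans ?_
    calc ∫ y, |f x - f y| ∂μ ≤ ∫ _, c ∂μ :=
          integral_mono_of_nonneg (ae_of_all _ fun _ => abs_nonneg _) (integrable_const _)
            (ae_of_all _ fun y => hc x y)
      _ = c := by simp
  have hsq : ∀ x, (t * (f x - ∫ y, f y ∂μ)) ^ 2 ≤ t ^ 2 * c ^ 2 := by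
    intro x
    rw [mul_pow]
    exact mul_le_mul_of_nonneg_left (sq_le_sq' (by linarith [(abs_le.1 (hd x)).1])
      (abs_le.1 (hd x)).2) (sq_nonneg _)
  have hint : Integrable (fun x => t * (f x - ∫ y, f y ∂μ) + Real.exp (t ^ 2 * c ^ 2)) μ :=
    ((hi.sub (integrable_const _)).const_mul t).add (integrable_const _)
  calc _ ≤ ∫ x, (t * (f x - ∫ y, f y ∂μ) + Real.exp (t ^ 2 * c ^ 2)) ∂μ := by
        refine integral_mono_of_nonneg (ae_of_all _ fun _ => (Real.exp_pos _).le) hint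
          (ae_of_all _ fun x => ?_)
        refine (Real.exp_le_add_exp_sq _).trans ?_
        have := Real.exp_le_exp.2 (hsq x)
        simp only; linarith
    _ = Real.exp (t ^ 2 * c ^ 2) := by
      have h0 : ∫ x, (f x - ∫ y, f y ∂μ) ∂μ = 0 := by
        rw [integral_sub hi (integrable_const _)]; simp
      have h1 : Integrable (fun x => t * (f x - ∫ y, f y ∂μ)) μ :=
        (hi.sub (integrable_const _)).const_mul t
      rw [integral_add h1 (integrable_const _), integral_const_mul, h0]
      simp

lemma piFinSuccAbove_zero_symm_apply {n : ℕ} (p : D × (Fin n → D)) :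
    (MeasurableEquiv.piFinSuccAbove (fun _ : Fin (n + 1) => D) 0).symm p = Fin.cons p.1 p.2 :=
  Fin.insertNth_zero' p.1 p.2

lemma measurable_cons {n : ℕ} :
    Measurable fun p : D × (Fin n → D) => (Fin.cons p.1 p.2 : Fin (n + 1) → D) := by
  have e : (fun p : D × (Fin n → D) => (Fin.cons p.1 p.2 : Fin (n + 1) → D))
      = (MeasurableEquiv.piFinSuccAbove (fun _ : Fin (n + 1) => D) 0).symm :=
    funext fun p => (piFinSuccAbove_zero_symm_apply p).symm
  rw [e]
  exact MeasurableEquiv.measurable _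

lemma integral_pi_succ (μ : Measure D) [IsProbabilityMeasure μ] {n : ℕ}
    {f : (Fin (n + 1) → D) → ℝ} (hf : Integrable f (Measure.pi fun _ => μ)) :
    ∫ z, f z ∂(Measure.pi fun _ => μ) =
      ∫ x, ∫ z, f (Fin.cons x z) ∂(Measure.pi fun _ => μ) ∂μ := by
  have mp := (measurePreserving_piFinSuccAbove (fun _ : Fin (n + 1) => μ) 0).symm
  have hf' : Integrable (f ∘ (MeasurableEquiv.piFinSuccAbove (fun _ : Fin (n + 1) => D) 0).symm)
      (μ.prod (Measure.pi fun _ : Fin n => μ)) := by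
    rw [mp.integrable_comp_emb (MeasurableEquiv.measurableEmbedding _)]
    exact hf
  rw [← mp.integral_comp' f]
  refine (integral_prod _ hf').trans ?_
  simp only [Function.comp_apply, piFinSuccAbove_zero_symm_apply]

/-- McDiarmid's inequality, in the form of a bound of the moment generating function. -/
theorem integral_exp_le_of_bounded_differences (μ : Measure D) [IsProbabilityMeasure μ] {c : ℝ}
    {B : ℝ} (t : ℝ) {n : ℕ} {f : (Fin n → D) → ℝ} (hf : Measurable f) (hB : ∀ z, |f z| ≤ B)
    (hc : ∀ z i x, |f (Function.update z i x) - f z| ≤ c) :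
    ∫ z, Real.exp (t * (f z - ∫ z', f z' ∂(Measure.pi fun _ => μ))) ∂(Measure.pi fun _ => μ)
      ≤ Real.exp (n * (t ^ 2 * c ^ 2)) := by
  induction n with
  | zero =>
    have : ∀ z, f z = f default := fun z => by rw [Subsingleton.elim z default]
    simp [this]
  | succ n ih =>
    have hexpB : ∀ (m : ℝ) (z : Fin (n + 1) → D), |Real.exp (t * (f z - m))|
        ≤ Real.exp (|t| * (B + |m|)) := by
      intro m z
      rw [Real.abs_exp]
      refine Real.exp_le_exp.2 ((le_abs_self _).trans ?_)
      rw [abs_mul]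
      gcongr
      exact (abs_sub _ _).trans (by gcongr; exact hB z)
    have hcons := measurable_cons (D := D) (n := n)
    -- Martingale step: `g` is the conditional mean given the first coordinate and inherits the
    -- bounded difference `c`. The induction hypothesis treats `f (Fin.cons x ·)` around `g x`, and
    -- the one-variable bound treats `g` around its mean.
    set g : D → ℝ := fun x => ∫ z, f (Fin.cons x z) ∂(Measure.pi fun _ => μ) with hg
    have hfc : ∀ x, Measurable fun z : Fin n → D => f (Fin.cons x z) := fun x =>
      hf.comp (hcons.comp (measurable_const.prodMk measurable_id))
    have hgm : Measurable g := by
      have : StronglyMeasurable (Function.uncurry fun x (z : Fin n → D) => f (Fin.cons x z)) :=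
        (hf.comp hcons).stronglyMeasurable
      exact this.integral_prod_right.measurable
    have hgB : ∀ x, |g x| ≤ B := fun x => by
      refine (abs_integral_le_integral_abs).trans ?_
      calc _ ≤ ∫ _ : Fin n → D, B ∂(Measure.pi fun _ => μ) :=
            integral_mono_of_nonneg (ae_of_all _ fun _ => abs_nonneg _) (integrable_const _)
              (ae_of_all _ fun y => hB _)
        _ = B := by simp
    have hgc : ∀ x y, |g x - g y| ≤ c := fun x y => by
      have h1 : ∀ x, Integrable (fun z : Fin n → D => f (Fin.cons x z)) (Measure.pi fun _ => μ) :=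
        fun x => integrable_of_abs_le (hfc x) fun z => hB _
      rw [hg, ← integral_sub (h1 x) (h1 y)]
      refine (abs_integral_le_integral_abs).trans ?_
      calc _ ≤ ∫ _ : Fin n → D, c ∂(Measure.pi fun _ => μ) :=
            integral_mono_of_nonneg (ae_of_all _ fun _ => abs_nonneg _) (integrable_const _)
              (ae_of_all _ fun z => ?_)
        _ = c := by simp
      have := hc (Fin.cons y z) 0 x
      rwa [Fin.update_cons_zero] at this
    have hmean : ∫ z', f z' ∂(Measure.pi fun _ => μ) = ∫ x, g x ∂μ :=
      integral_pi_succ μ (integrable_of_abs_le hf hB)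
    rw [hmean]
    set m := ∫ x, g x ∂μ with hm
    have hexpm : Measurable fun z : Fin (n + 1) → D => Real.exp (t * (f z - m)) :=
      Real.measurable_exp.comp ((hf.sub_const m).const_mul t)
    rw [integral_pi_succ μ (integrable_of_abs_le hexpm (hexpB m))]
    have hstep : ∀ x, ∫ z, Real.exp (t * (f (Fin.cons x z) - m)) ∂(Measure.pi fun _ : Fin n => μ)
        ≤ Real.exp (n * (t ^ 2 * c ^ 2)) * Real.exp (t * (g x - m)) := by
      intro x
      have e : ∀ z : Fin n → D, Real.exp (t * (f (Fin.cons x z) - m))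
          = Real.exp (t * (f (Fin.cons x z) - g x)) * Real.exp (t * (g x - m)) := fun z => by
        rw [← Real.exp_add]; congr 1; ring
      simp_rw [e]
      rw [integral_mul_const]
      refine mul_le_mul_of_nonneg_right ?_ (Real.exp_pos _).le
      refine ih (hfc x) (fun z => hB _) fun z i y => ?_
      have := hc (Fin.cons x z) i.succ y
      rwa [← Fin.cons_update] at this
    have hgi : Integrable (fun x => Real.exp (t * (g x - m))) μ := by
      refine integrable_of_abs_le (B := Real.exp (|t| * (B + |m|)))
        (Real.measurable_exp.comp ((hgm.sub_const m).const_mul t)) fun x => ?_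
      rw [Real.abs_exp]
      refine Real.exp_le_exp.2 ((le_abs_self _).trans ?_)
      rw [abs_mul]
      gcongr
      exact (abs_sub _ _).trans (by gcongr; exact hgB x)
    calc _ ≤ ∫ x, Real.exp (n * (t ^ 2 * c ^ 2)) * Real.exp (t * (g x - m)) ∂μ :=
          integral_mono_of_nonneg (ae_of_all _ fun _ => integral_nonneg fun _ => (Real.exp_pos _).le)
            (hgi.const_mul _) (ae_of_all _ hstep)
      _ ≤ Real.exp (n * (t ^ 2 * c ^ 2)) * Real.exp (t ^ 2 * c ^ 2) := by
        rw [integral_const_mul]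
        exact mul_le_mul_of_nonneg_left (integral_exp_mul_sub_integral_le μ hgm hgB hgc t)
          (Real.exp_pos _).le
      _ = _ := by rw [← Real.exp_add]; push_cast; ring_nf

/-- Random variables with sub-Gaussian constants of order `1 / n` converge to zero almost surely. -/
theorem ae_tendsto_zero_of_subgaussian {P : Measure D} [IsProbabilityMeasure P] {W : ℕ → D → ℝ}
    {C : ℝ} (hC : 0 < C) (hint : ∀ n, 2 ≤ n → ∀ t : ℝ, Integrable (fun ω => Real.exp (t * W n ω)) P)
    (hW : ∀ n, 2 ≤ n → ∀ t : ℝ, ∫ ω, Real.exp (t * W n ω) ∂P ≤ Real.exp (C * t ^ 2 / n)) :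
    ∀ᵐ ω ∂P, Tendsto (fun n => W n ω) atTop (𝓝 0) := by
  have tail : ∀ ε : ℝ, 0 < ε → ∀ n, 2 ≤ n →
      P.real {ω | ε ≤ |W n ω|} ≤ 2 * Real.exp (-(ε ^ 2 / (4 * C))) ^ n := by
    intro ε hε n hn
    have hn0 : (0 : ℝ) < n := by exact_mod_cast (by omega : 0 < n)
    -- This is the minimiser of `-t * ε + C * t ^ 2 / n`, with minimum `-n * ε ^ 2 / (4 * C)`; the
    -- tails are therefore geometric in `n`.
    set t : ℝ := n * ε / (2 * C) with ht
    have ht0 : 0 ≤ t := by positivity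
    have ex : Real.exp (-t * ε) * Real.exp (C * t ^ 2 / n) = Real.exp (-(ε ^ 2 / (4 * C))) ^ n := by
      rw [← Real.exp_add, ← Real.exp_nat_mul]
      congr 1
      rw [ht]; field_simp; ring
    have h1 : P.real {ω | ε ≤ W n ω} ≤ Real.exp (-(ε ^ 2 / (4 * C))) ^ n := by
      rw [← ex]
      exact (measure_ge_le_exp_mul_mgf ε ht0 (hint n hn t)).trans
        (mul_le_mul_of_nonneg_left (hW n hn t) (Real.exp_pos _).le)
    have h2 : P.real {ω | W n ω ≤ -ε} ≤ Real.exp (-(ε ^ 2 / (4 * C))) ^ n := by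
      rw [← ex]
      have := measure_le_le_exp_mul_mgf (-ε) (neg_nonpos.2 ht0) (hint n hn (-t))
      refine this.trans ?_
      rw [neg_neg, mul_neg, ← neg_mul]
      refine mul_le_mul_of_nonneg_left ?_ (Real.exp_pos _).le
      have h := hW n hn (-t)
      rwa [neg_sq] at h
    have hsub : {ω | ε ≤ |W n ω|} ⊆ {ω | ε ≤ W n ω} ∪ {ω | W n ω ≤ -ε} := by
      intro ω hω
      rcases le_abs.1 (show ε ≤ |W n ω| from hω) with h | h
      · exact Or.inl h
      · exact Or.inr (by simp only [Set.mem_ofPred_eq]; linarith)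
    calc _ ≤ P.real ({ω | ε ≤ W n ω} ∪ {ω | W n ω ≤ -ε}) := measureReal_mono hsub
      _ ≤ _ := measureReal_union_le _ _
      _ ≤ _ := by linarith
  have key : ∀ ε : ℝ, 0 < ε → ∀ᵐ ω ∂P, ∀ᶠ n in atTop, |W n ω| < ε := by
    intro ε hε
    have hs : Summable fun n : ℕ => 2 * Real.exp (-(ε ^ 2 / (4 * C))) ^ n :=
      (summable_geometric_of_lt_one (Real.exp_pos _).le
        (Real.exp_lt_one_iff.2 (neg_lt_zero.2 (by positivity)))).mul_left 2
    -- The tail bound starts at sample size two, so Borel–Cantelli is applied to the shifted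
    -- sequence.
    have hfin : (∑' n, P {ω | ε ≤ |W (n + 2) ω|}) ≠ ⊤ := by
      have h2 := (summable_nat_add_iff 2).2 hs
      refine ne_top_of_le_ne_top h2.tsum_ofReal_ne_top (ENNReal.tsum_le_tsum fun n => ?_)
      rw [← ofReal_measureReal]
      exact ENNReal.ofReal_le_ofReal (tail ε hε (n + 2) (by omega))
    filter_upwards [ae_eventually_notMem hfin] with ω hω
    rw [← map_add_atTop_eq_nat 2, eventually_map]
    filter_upwards [hω] with n hn
    simpa using hn
  have all : ∀ᵐ ω ∂P, ∀ m : ℕ, ∀ᶠ n in atTop, |W n ω| < 1 / ((m : ℝ) + 1) :=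
    ae_all_iff.2 fun m => key _ (by positivity)
  filter_upwards [all] with ω hω
  rw [Metric.tendsto_nhds]
  intro ε hε
  obtain ⟨m, hm⟩ := exists_nat_one_div_lt hε
  filter_upwards [hω m] with n hn
  rw [Real.dist_eq, sub_zero]
  exact hn.trans hm

end Concentration

/-! ### Concentration for i.i.d. samples and for randomly broken ties -/

section Sample
variable {Ω D : Type*} [MeasurableSpace Ω] [MeasurableSpace D]

lemma map_sample_eq_pi {P : Measure Ω} {μ : Measure D} [IsProbabilityMeasure P]
    {Z : ℕ → Ω → D} (hZ : ∀ l, Measurable (Z l)) (hind : iIndepFun Z P)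
    (hlaw : ∀ l, P.map (Z l) = μ) (n : ℕ) :
    P.map (fun ω (l : Fin n) => Z l ω) = Measure.pi fun _ => μ := by
  have h1 : iIndepFun (fun l : Fin n => Z l) P := hind.precomp Fin.val_injective
  have h2 := (iIndepFun_iff_map_fun_eq_pi_map (fun l : Fin n => (hZ l).aemeasurable)).1 h1
  rw [h2]
  simp only [hlaw]

/-- Bounded statistics of an i.i.d. sample with bounded differences concentrate around their mean. -/
theorem ae_tendsto_sub_integral {P : Measure Ω} [IsProbabilityMeasure P] {μ : Measure D}
    [IsProbabilityMeasure μ] {Z : ℕ → Ω → D} (hZ : ∀ l, Measurable (Z l)) (hind : iIndepFun Z P)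
    (hlaw : ∀ l, P.map (Z l) = μ) {f : ∀ n, (Fin n → D) → ℝ} (hf : ∀ n, Measurable (f n))
    {B C : ℝ} (hB : ∀ n z, |f n z| ≤ B) (hC : 0 < C)
    (hc : ∀ n z i x, |f n (Function.update z i x) - f n z| ≤ C / n) :
    ∀ᵐ ω ∂P, Tendsto (fun n => f n (fun l => Z l ω) - ∫ z, f n z ∂(Measure.pi fun _ => μ))
      atTop (𝓝 0) := by
  have hζ : ∀ n, Measurable fun ω (l : Fin n) => Z l ω :=
    fun n => measurable_pi_lambda _ fun l => hZ l
  refine ae_tendsto_zero_of_subgaussian (C := C ^ 2) (by positivity) (fun n _ t => ?_)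
    (fun n hn t => ?_)
  · set m := ∫ z, f n z ∂(Measure.pi fun _ => μ)
    refine integrable_of_abs_le (B := Real.exp (|t| * (B + |m|)))
      (Real.measurable_exp.comp ((((hf n).comp (hζ n)).sub_const m).const_mul t)) fun ω => ?_
    rw [Real.abs_exp]
    refine Real.exp_le_exp.2 ((le_abs_self _).trans ?_)
    rw [abs_mul]
    gcongr
    exact (abs_sub _ _).trans (by gcongr; exact hB n _)
  · have hn0 : (0 : ℝ) < n := by exact_mod_cast (by omega : 0 < n)
    set m := ∫ z, f n z ∂(Measure.pi fun _ => μ) with hm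
    have hmeas : Measurable fun z => Real.exp (t * (f n z - m)) :=
      Real.measurable_exp.comp (((hf n).sub_const m).const_mul t)
    have h1 := integral_exp_le_of_bounded_differences μ t (hf n) (hB n) (hc n)
    rw [← map_sample_eq_pi hZ hind hlaw n, map_sample_eq_pi hZ hind hlaw n, ← hm,
      ← map_sample_eq_pi hZ hind hlaw n, integral_map (hζ n).aemeasurable
      hmeas.aestronglyMeasurable] at h1
    refine h1.trans (le_of_eq ?_)
    congr 1
    field_simp

/-- A bound for the moment generating function of a weighted average. -/
lemma sum_mul_exp_le {ι : Type*} [Fintype ι] {w h : ι → ℝ} (hw : ∀ l, 0 ≤ w l)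
    (hw1 : ∑ l, w l = 1) (h0 : ∀ l, 0 ≤ h l) (h1 : ∀ l, h l ≤ 1) (s : ℝ) :
    ∑ l, w l * Real.exp (s * (h l - ∑ m, w m * h m)) ≤ Real.exp (s ^ 2) := by
  set a := ∑ m, w m * h m with ha
  have ha0 : 0 ≤ a := Finset.sum_nonneg fun l _ => mul_nonneg (hw l) (h0 l)
  have ha1 : a ≤ 1 := by
    rw [← hw1]
    exact Finset.sum_le_sum fun l _ => mul_le_of_le_one_right (hw l) (h1 l)
  have hx : ∀ l, Real.exp (s * (h l - a)) ≤ s * (h l - a) + Real.exp (s ^ 2) := fun l => by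
    refine (Real.exp_le_add_exp_sq _).trans (add_le_add le_rfl (Real.exp_le_exp.2 ?_))
    rw [mul_pow]
    have : (h l - a) ^ 2 ≤ 1 := by
      rw [sq_le_one_iff_abs_le_one, abs_le]
      constructor <;> linarith [h0 l, h1 l]
    nlinarith [sq_nonneg s]
  calc _ ≤ ∑ l, w l * (s * (h l - a) + Real.exp (s ^ 2)) :=
        Finset.sum_le_sum fun l _ => mul_le_mul_of_nonneg_left (hx l) (hw l)
    _ = s * (∑ l, w l * h l - a * ∑ l, w l) + Real.exp (s ^ 2) * ∑ l, w l := by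
      rw [Finset.mul_sum, Finset.mul_sum, ← Finset.sum_sub_distrib, Finset.mul_sum,
        ← Finset.sum_add_distrib]
      exact Finset.sum_congr rfl fun l _ => by ring
    _ = Real.exp (s ^ 2) := by rw [hw1, ← ha]; ring

/-- The deviation of a selected average from its conditional mean given the sample. -/
noncomputable def nnDeviation {E : Type*} [PseudoMetricSpace E] {n : ℕ} (v : Fin n → E)
    (H : Fin n → Fin n → ℝ) (N : Fin n → Fin n) : ℝ :=
  (∑ k, (H k (N k) - ∑ l, nnWeight v k l * H k l)) / n

lemma abs_nnDeviation_le_one {E : Type*} [PseudoMetricSpace E] {n : ℕ} (v : Fin n → E)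
    {H : Fin n → Fin n → ℝ} (H0 : ∀ k l, 0 ≤ H k l) (H1 : ∀ k l, H k l ≤ 1) (N : Fin n → Fin n) :
    |nnDeviation v H N| ≤ 1 := by
  rw [nnDeviation, abs_div, Nat.abs_cast]
  refine div_le_one_of_le₀ ((Finset.abs_sum_le_sum_abs _ _).trans ?_) (Nat.cast_nonneg _)
  calc _ ≤ ∑ _k : Fin n, (1 : ℝ) := Finset.sum_le_sum fun k _ => by
        rw [sum_nnWeight_mul, abs_le]
        constructor <;> linarith [H0 k (N k), H1 k (N k), finAvg_nonneg (nearestIdx v k) (H0 k),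
          finAvg_le_one (nearestIdx v k) (H1 k)]
    _ = n := by simp

/-- Conditionally on the sample, `nnDeviation` is an average of `n` independent centred variables
with values in `[-1, 1]`. Each contributes a factor at most `exp ((t / n) ^ 2)` to the moment
generating function, and the product of the `n` factors is `exp (t ^ 2 / n)`. -/
theorem integrable_and_integral_exp_nnDeviation_le {E : Type*} [PseudoMetricSpace E]
    {P : Measure Ω} [IsProbabilityMeasure P] {n : ℕ} (hn : 2 ≤ n) {Z : Fin n → Ω → D}
    (hZ : ∀ l, Measurable (Z l)) {g : D → E} {N : Fin n → Ω → Fin n} (hN : IsRandomNN P Z g N)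
    {H : (Fin n → D) → Fin n → Fin n → ℝ} (hH : ∀ k l, Measurable fun z => H z k l)
    (hw : ∀ k l, Measurable fun z : Fin n → D => nnWeight (fun i => g (z i)) k l)
    (H0 : ∀ z k l, 0 ≤ H z k l) (H1 : ∀ z k l, H z k l ≤ 1) (t : ℝ) :
    Integrable (fun ω => Real.exp (t * nnDeviation (fun l => g (Z l ω))
        (H fun l => Z l ω) fun k => N k ω)) P ∧
    ∫ ω, Real.exp (t * nnDeviation (fun l => g (Z l ω)) (H fun l => Z l ω) fun k => N k ω) ∂P
      ≤ Real.exp (t ^ 2 / n) := by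
  classical
  have hn0 : (n : ℝ) ≠ 0 := by exact_mod_cast (by omega : n ≠ 0)
  have hζ : Measurable fun ω (l : Fin n) => Z l ω := measurable_pi_lambda _ hZ
  set ζ : Ω → Fin n → D := fun ω l => Z l ω with hζd
  set s : ℝ := t / n with hs
  set row : (Fin n → D) → Fin n → ℝ := fun z k => ∑ l, nnWeight (fun i => g (z i)) k l * H z k l
    with hrow
  set e : (Fin n → Fin n) → (Fin n → D) → ℝ :=
    fun j z => ∏ k, Real.exp (s * (H z k (j k) - row z k)) with he
  have hrowm : ∀ k, Measurable fun z => row z k := fun k =>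
    Finset.measurable_sum _ fun l _ => (hw k l).mul (hH k l)
  have hem : ∀ j, Measurable (e j) := fun j => Finset.measurable_prod _ fun k _ =>
    Real.measurable_exp.comp (((hH k (j k)).sub (hrowm k)).const_mul s)
  have hdev : ∀ (j : Fin n → Fin n) z, Real.exp (t * nnDeviation (fun l => g (z l)) (H z) j)
      = e j z := by
    intro j z
    rw [he]
    simp only
    rw [← Real.exp_sum, nnDeviation, ← Finset.mul_sum, hs]
    congr 1
    field_simp
    rfl
  have heB : ∀ j z, |e j z| ≤ Real.exp |t| := by
    intro j z
    rw [← hdev, Real.abs_exp]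
    refine Real.exp_le_exp.2 ((le_abs_self _).trans ?_)
    rw [abs_mul]
    exact mul_le_of_le_one_right (abs_nonneg _) (abs_nnDeviation_le_one _ (H0 z) (H1 z) _)
  set A : (Fin n → Fin n) → Set Ω := fun j => {ω | ∀ k, N k ω = j k} with hA
  have hAm : ∀ j, MeasurableSet (A j) := fun j => by
    have : A j = ⋂ k, N k ⁻¹' {j k} := by ext ω; simp [hA]
    rw [this]
    exact MeasurableSet.iInter fun k => hN.measurable k (measurableSet_singleton _)
  -- The neighbours take finitely many joint values `j`. On each event `A j` the exponential is a
  -- function of the sample, which can be pulled out of the conditional expectation.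
  have hsplit : ∀ ω, Real.exp (t * nnDeviation (fun l => g (Z l ω)) (H (ζ ω)) fun k => N k ω)
      = ∑ j, (A j).indicator (fun _ => (1 : ℝ)) ω * e j (ζ ω) := by
    intro ω
    rw [Finset.sum_eq_single fun k => N k ω]
    · rw [Set.indicator_of_mem (by simp [hA]), one_mul, ← hdev]
    · intro j _ hj
      rw [Set.indicator_of_notMem, zero_mul]
      intro h
      exact hj (funext fun k => (h k).symm)
    · simp
  have hi1 : ∀ j, Integrable ((A j).indicator fun _ => (1 : ℝ)) P := fun j =>
    (integrable_const _).indicator (hAm j)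
  have hi2 : ∀ j, Integrable (((A j).indicator fun _ => (1 : ℝ)) * fun ω => e j (ζ ω)) P :=
    fun j => (hi1 j).mul_bdd (c := Real.exp |t|) ((hem j).comp hζ).aestronglyMeasurable
      (ae_of_all _ fun ω => heB j _)
  have hce : ∀ j, P[((A j).indicator fun _ => (1 : ℝ)) * (fun ω => e j (ζ ω)) |
      MeasurableSpace.comap ζ MeasurableSpace.pi] =ᵐ[P]
      fun ω => ∏ k, (nnWeight (fun l => g (Z l ω)) k (j k) *
        Real.exp (s * (H (ζ ω) k (j k) - row (ζ ω) k))) := by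
    intro j
    have hsm : StronglyMeasurable[MeasurableSpace.comap ζ MeasurableSpace.pi] fun ω => e j (ζ ω) :=
      ((hem j).comp (comap_measurable ζ)).stronglyMeasurable
    refine (condExp_mul_of_stronglyMeasurable_right hsm (hi2 j) (hi1 j)).trans ?_
    filter_upwards [hN.cond_law j] with ω hω
    rw [Pi.mul_apply, hω, Finset.prod_mul_distrib]
    rfl
  have hi3 : ∀ j : Fin n → Fin n, Integrable (fun ω => ∏ k, (nnWeight (fun l => g (Z l ω)) k (j k) *
        Real.exp (s * (H (ζ ω) k (j k) - row (ζ ω) k)))) P :=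
    fun j => integrable_condExp.congr (hce j)
  have hfun : (fun ω => Real.exp (t * nnDeviation (fun l => g (Z l ω)) (H (ζ ω)) fun k => N k ω))
      = fun ω => ∑ j, (A j).indicator (fun _ => (1 : ℝ)) ω * e j (ζ ω) := funext hsplit
  rw [hfun]
  have hi2' : ∀ j, Integrable (fun ω => (A j).indicator (fun _ => (1 : ℝ)) ω * e j (ζ ω)) P := hi2
  refine ⟨integrable_finsetSum _ fun j _ => hi2' j, ?_⟩
  rw [integral_finsetSum _ fun j _ => hi2' j]
  have hj : ∀ j : Fin n → Fin n, ∫ ω, (A j).indicator (fun _ => (1 : ℝ)) ω * e j (ζ ω) ∂P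
      = ∫ ω, ∏ k, (nnWeight (fun l => g (Z l ω)) k (j k) *
        Real.exp (s * (H (ζ ω) k (j k) - row (ζ ω) k))) ∂P := fun j => by
    rw [← integral_congr_ae (hce j), integral_condExp hζ.comap_le]
    rfl
  simp_rw [hj]
  rw [← integral_finsetSum _ fun j _ => hi3 j]
  calc _ ≤ ∫ _ω, Real.exp (t ^ 2 / n) ∂P := by
        refine integral_mono (integrable_finsetSum _ fun j _ => hi3 j) (integrable_const _)
          fun ω => ?_
        simp only
        -- Conditional independence enters here: the sum over all joint selections of products of
        -- weights is a product over `k` of row sums.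
        rw [← Fintype.prod_sum (fun k l => nnWeight (fun l => g (Z l ω)) k l *
          Real.exp (s * (H (ζ ω) k l - row (ζ ω) k)))]
        calc _ ≤ ∏ _k : Fin n, Real.exp (s ^ 2) := by
              refine Finset.prod_le_prod (fun k _ => Finset.sum_nonneg fun l _ =>
                mul_nonneg (nnWeight_nonneg _ _ _) (Real.exp_pos _).le) fun k _ => ?_
              exact sum_mul_exp_le (fun l => nnWeight_nonneg _ _ _) (sum_nnWeight hn _ k)
                (H0 (ζ ω) k) (H1 (ζ ω) k) s
          _ = Real.exp (t ^ 2 / n) := by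
            rw [Finset.prod_const, Finset.card_univ, Fintype.card_fin, ← Real.exp_nat_mul, hs]
            congr 1
            field_simp
    _ = Real.exp (t ^ 2 / n) := by simp

end Sample

/-! ### Measurability -/

section Measurability
variable {D : Type*} [MeasurableSpace D]

lemma measurableSet_mem_nearestIdx {E : Type*} [PseudoMetricSpace E] [MeasurableSpace E]
    [OpensMeasurableSpace E] [SecondCountableTopology E] {n : ℕ} (k l : Fin n) :
    MeasurableSet {v : Fin n → E | l ∈ nearestIdx v k} := by
  have : {v : Fin n → E | l ∈ nearestIdx v k} = {v | l ≠ k} ∩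
      ⋂ m, ({v | m = k} ∪ {v | dist (v k) (v l) ≤ dist (v k) (v m)}) := by
    ext v
    simp only [mem_nearestIdx, Set.mem_ofPred_eq, Set.mem_inter_iff, Set.mem_iInter,
      Set.mem_union, or_iff_not_imp_left]
  rw [this]
  refine (MeasurableSet.const _).inter (MeasurableSet.iInter fun m =>
    (MeasurableSet.const _).union (measurableSet_le ?_ ?_))
  · exact (measurable_pi_apply k).dist (measurable_pi_apply l)
  · exact (measurable_pi_apply k).dist (measurable_pi_apply m)

lemma measurable_nnWeight {E : Type*} [PseudoMetricSpace E] [MeasurableSpace E]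
    [OpensMeasurableSpace E] [SecondCountableTopology E] {n : ℕ} (k l : Fin n) :
    Measurable fun v : Fin n → E => nnWeight v k l := by
  classical
  have : (fun v : Fin n → E => nnWeight v k l) = fun v =>
      {v : Fin n → E | l ∈ nearestIdx v k}.indicator (fun _ => (1 : ℝ)) v /
        ∑ m, {v : Fin n → E | m ∈ nearestIdx v k}.indicator (fun _ => (1 : ℝ)) v := by
    funext v
    simp only [Set.indicator_apply, Set.mem_ofPred_eq, Finset.sum_boole, nnWeight]
    rw [Finset.filter_mem_eq_inter, Finset.univ_inter]
    split_ifs <;> simp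
  rw [this]
  exact (measurable_const.indicator (measurableSet_mem_nearestIdx k l)).div
    (Finset.measurable_sum _ fun m _ =>
      measurable_const.indicator (measurableSet_mem_nearestIdx k m))

lemma measurable_ecdf {n : ℕ} {y : D → Fin n → ℝ} {x : D → ℝ} (hy : ∀ l, Measurable fun z => y z l)
    (hx : Measurable x) : Measurable fun z => ecdf (y z) (x z) := by
  simp_rw [ecdf_eq_sum]
  refine (Finset.measurable_sum _ fun l _ => ?_).div_const _
  exact Measurable.ite (measurableSet_le (hy l) hx) measurable_const measurable_const

lemma measurable_nnStat {E : Type*} [PseudoMetricSpace E] [MeasurableSpace E]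
    [OpensMeasurableSpace E] [SecondCountableTopology E] {n : ℕ} {v : D → E} (hv : Measurable v)
    {u : D → ℝ} (hu : Measurable u) :
    Measurable fun z : Fin n → D => nnStat (fun l => v (z l)) fun l => u (z l) := by
  have hu' : ∀ l : Fin n, Measurable fun z : Fin n → D => u (z l) := fun l =>
    hu.comp (measurable_pi_apply l)
  refine (Finset.measurable_sum _ fun k _ => Finset.measurable_sum _ fun l _ => ?_).div_const _
  refine Measurable.mul ?_ (measurable_ecdf hu' ((hu' k).min (hu' l)))
  exact (measurable_nnWeight k l).comp
    (measurable_pi_lambda _ fun i => hv.comp (measurable_pi_apply i))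

lemma measurable_rankStat (j : ℕ) {n : ℕ} {u : D → ℝ} (hu : Measurable u) :
    Measurable fun z : Fin n → D => rankStat j fun l => u (z l) := by
  have hu' : ∀ l : Fin n, Measurable fun z : Fin n → D => u (z l) := fun l =>
    hu.comp (measurable_pi_apply l)
  exact (Finset.measurable_sum _ fun k _ => (measurable_ecdf hu' (hu' k)).pow_const j).div_const _

end Measurability

/-! ### Means of the statistics -/

section Means
variable {D : Type*} [MeasurableSpace D] {n : ℕ}

/-- Redrawing one coordinate independently preserves the product law. It gives Fubini's theorem for
an arbitrary single coordinate without reindexing the others. -/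
lemma measurePreserving_update (μ : Measure D) [IsProbabilityMeasure μ] (k : Fin n) :
    MeasurePreserving (fun p : (Fin n → D) × D => Function.update p.1 k p.2)
      ((Measure.pi fun _ => μ).prod μ) (Measure.pi fun _ => μ) := by
  have hm : Measurable fun p : (Fin n → D) × D => Function.update p.1 k p.2 := measurable_update'
  refine ⟨hm, (Measure.pi_eq fun s hs => ?_).symm⟩
  rw [Measure.map_apply hm (MeasurableSet.univ_pi hs)]
  have : (fun p : (Fin n → D) × D => Function.update p.1 k p.2) ⁻¹' Set.univ.pi s
      = (Set.univ.pi (Function.update s k Set.univ)) ×ˢ s k := by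
    ext p
    simp only [Set.mem_preimage, Set.mem_univ_pi, Set.mem_prod]
    constructor
    · intro h
      refine ⟨fun i => ?_, by simpa using h k⟩
      by_cases hi : i = k
      · subst hi; simp
      · simpa [hi] using h i
    · rintro ⟨h, hk⟩ i
      by_cases hi : i = k
      · subst hi; simpa using hk
      · simpa [hi] using h i
  rw [this, Measure.prod_prod, Measure.pi_pi, ← Finset.mul_prod_erase Finset.univ _
    (Finset.mem_univ k), ← Finset.mul_prod_erase Finset.univ (fun i => μ (s i)) (Finset.mem_univ k)]
  simp only [Function.update_self, measure_univ, one_mul]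
  rw [mul_comm]
  congr 1
  refine Finset.prod_congr rfl fun i hi => ?_
  rw [Function.update_of_ne (Finset.ne_of_mem_erase hi)]

lemma integral_pi_eq_integral_update (μ : Measure D) [IsProbabilityMeasure μ] (k : Fin n)
    {f : (Fin n → D) → ℝ} (hf : Integrable f (Measure.pi fun _ => μ)) :
    ∫ z, f z ∂(Measure.pi fun _ => μ)
      = ∫ z, ∫ x, f (Function.update z k x) ∂μ ∂(Measure.pi fun _ => μ) := by
  have mp := measurePreserving_update μ k
  have h1 : Integrable (fun p : (Fin n → D) × D => f (Function.update p.1 k p.2))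
      ((Measure.pi fun _ => μ).prod μ) := mp.integrable_comp_of_integrable hf
  rw [← integral_prod _ h1]
  conv_lhs => rw [← mp.map_eq]
  rw [integral_map mp.measurable.aemeasurable (by rw [mp.map_eq]; exact hf.aestronglyMeasurable)]

lemma integral_pi_eval (μ : Measure D) [IsProbabilityMeasure μ] (k : Fin n) {f : D → ℝ}
    (hf : Measurable f) :
    ∫ z : Fin n → D, f (z k) ∂(Measure.pi fun _ => μ) = ∫ x, f x ∂μ := by
  have mp := measurePreserving_eval (fun _ : Fin n => μ) k
  conv_rhs => rw [← mp.map_eq]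
  rw [integral_map mp.measurable.aemeasurable hf.aestronglyMeasurable]

/-- Inside an integral over the sample, `a (z k)` may be replaced by `b (z k)` if the remaining
factor depends on `z k` only through `v (z k)` and `a`, `b` have the same conditional expectation
given `v`. -/
lemma integral_mul_eq_of_condExp_eq {E : Type*} [MeasurableSpace E] (μ : Measure D)
    [IsProbabilityMeasure μ] {v : D → E} {a b : D → ℝ} (ha : Measurable a) (hb : Measurable b)
    {A B : ℝ} (haA : ∀ x, |a x| ≤ A) (hbA : ∀ x, |b x| ≤ A)
    (hab : ∀ φ : E → ℝ, Measurable φ → (∀ e, |φ e| ≤ B) →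
      ∫ x, a x * φ (v x) ∂μ = ∫ x, b x * φ (v x) ∂μ)
    (k : Fin n) {Φ : (Fin n → D) → ℝ} (hΦ : Measurable Φ) (hΦB : ∀ z, |Φ z| ≤ B)
    (hdep : ∀ z, ∃ φ : E → ℝ, Measurable φ ∧ (∀ e, |φ e| ≤ B) ∧
      ∀ x, Φ (Function.update z k x) = φ (v x)) :
    ∫ z, a (z k) * Φ z ∂(Measure.pi fun _ => μ) = ∫ z, b (z k) * Φ z ∂(Measure.pi fun _ => μ) := by
  have hint : ∀ c : D → ℝ, Measurable c → (∀ x, |c x| ≤ A) →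
      Integrable (fun z : Fin n → D => c (z k) * Φ z) (Measure.pi fun _ => μ) := by
    intro c hc hcA
    refine integrable_of_abs_le (B := A * B) ((hc.comp (measurable_pi_apply k)).mul hΦ) fun z => ?_
    rw [abs_mul]
    exact mul_le_mul (hcA _) (hΦB z) (abs_nonneg _) ((abs_nonneg _).trans (hcA (z k)))
  rw [integral_pi_eq_integral_update μ k (hint a ha haA),
    integral_pi_eq_integral_update μ k (hint b hb hbA)]
  refine integral_congr_ae (ae_of_all _ fun z => ?_)
  obtain ⟨φ, hφ, hφB, h⟩ := hdep z
  simp only [Function.update_self, h]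
  exact hab φ hφ hφB

/-- The distribution function of `u` under `μ`. -/
noncomputable def distFun (μ : Measure D) (u : D → ℝ) (x : ℝ) : ℝ :=
  ∫ d, (if u d ≤ x then (1 : ℝ) else 0) ∂μ

lemma integrable_ite_le (μ : Measure D) [IsProbabilityMeasure μ] {u : D → ℝ} (hu : Measurable u)
    (x : ℝ) : Integrable (fun d => if u d ≤ x then (1 : ℝ) else 0) μ :=
  integrable_of_abs_le (B := 1)
    (Measurable.ite (measurableSet_le hu measurable_const) measurable_const measurable_const)
    fun d => by split_ifs <;> norm_num

lemma distFun_nonneg (μ : Measure D) (u : D → ℝ) (x : ℝ) : 0 ≤ distFun μ u x :=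
  integral_nonneg fun d => by simp only; split_ifs <;> norm_num

lemma distFun_le_one (μ : Measure D) [IsProbabilityMeasure μ] {u : D → ℝ} (hu : Measurable u)
    (x : ℝ) : distFun μ u x ≤ 1 := by
  calc distFun μ u x ≤ ∫ _, (1 : ℝ) ∂μ :=
        integral_mono (integrable_ite_le μ hu x) (integrable_const _) fun d => by
          simp only; split_ifs <;> norm_num
    _ = 1 := by simp

lemma distFun_mono (μ : Measure D) [IsProbabilityMeasure μ] {u : D → ℝ} (hu : Measurable u) :
    Monotone (distFun μ u) := by
  intro a b hab
  refine integral_mono (integrable_ite_le μ hu a) (integrable_ite_le μ hu b) fun d => ?_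
  simp only
  split_ifs with h1 h2
  · exact le_rfl
  · exact absurd (h1.trans hab) h2
  · exact zero_le_one
  · exact le_rfl

lemma measurable_distFun (μ : Measure D) [IsProbabilityMeasure μ] {u : D → ℝ} (hu : Measurable u) :
    Measurable (distFun μ u) := (distFun_mono μ hu).measurable

/-- The empirical distribution function, evaluated at a sample point, is close to the true one. -/
lemma integral_abs_ecdf_sub_distFun_le (μ : Measure D) [IsProbabilityMeasure μ] {u : D → ℝ}
    (hu : Measurable u) (k : Fin n) :
    ∫ z : Fin n → D, |ecdf (fun l => u (z l)) (u (z k)) - distFun μ u (u (z k))|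
      ∂(Measure.pi fun _ => μ) ≤ 1 / √n := by
  have hn : (0 : ℝ) < n := by exact_mod_cast (Fin.pos k)
  have hu' : ∀ l : Fin n, Measurable fun z : Fin n → D => u (z l) := fun l =>
    hu.comp (measurable_pi_apply l)
  set c : Fin n → (Fin n → D) → ℝ := fun l z =>
    (if u (z l) ≤ u (z k) then (1 : ℝ) else 0) - distFun μ u (u (z k)) with hc
  have hcm : ∀ l, Measurable (c l) := fun l =>
    (Measurable.ite (measurableSet_le (hu' l) (hu' k)) measurable_const measurable_const).sub
      ((measurable_distFun μ hu).comp (hu' k))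
  have hc1 : ∀ l z, |c l z| ≤ 1 := fun l z => by
    have h0 := distFun_nonneg μ u (u (z k))
    have h1 := distFun_le_one μ hu (u (z k))
    simp only [hc]
    rw [abs_le]
    split_ifs <;> constructor <;> linarith
  have hcc1 : ∀ l m z, |c l z * c m z| ≤ 1 := fun l m z => by
    rw [abs_mul]; exact mul_le_one₀ (hc1 l z) (abs_nonneg _) (hc1 m z)
  have hcci : ∀ l m, Integrable (fun z => c l z * c m z) (Measure.pi fun _ => μ) := fun l m =>
    integrable_of_abs_le ((hcm l).mul (hcm m)) (hcc1 l m)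
  -- For `l ≠ k` the variable `c l` is centred once coordinate `l` is integrated out, and neither `c
  -- m` nor the threshold `u (z k)` involves that coordinate. The term `c k` is not centred, but an
  -- off-diagonal pair always has an index other than `k`, so only the diagonal survives in the
  -- second moment.
  have hzero : ∀ l m, l ≠ m → l ≠ k → ∫ z, c l z * c m z ∂(Measure.pi fun _ => μ) = 0 := by
    intro l m hlm hlk
    rw [integral_pi_eq_integral_update μ l (hcci l m)]
    refine integral_eq_zero_of_ae (ae_of_all _ fun z => ?_)
    simp only [hc, Function.update_self, Function.update_of_ne hlm.symm,
      Function.update_of_ne hlk.symm, Pi.zero_apply]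
    rw [integral_mul_const, integral_sub (integrable_ite_le μ hu _) (integrable_const _)]
    simp [distFun]
  have hdiff : ∀ z : Fin n → D, ecdf (fun l => u (z l)) (u (z k)) - distFun μ u (u (z k))
      = (∑ l, c l z) / n := fun z => by
    simp only [hc]
    rw [ecdf_eq_sum, Finset.sum_sub_distrib, sub_div]
    congr 1
    simp [hn.ne']
  have hsq : ∫ z, ((∑ l, c l z) / n) ^ 2 ∂(Measure.pi fun _ => μ) ≤ 1 / n := by
    have e : ∀ z, ((∑ l, c l z) / n) ^ 2 = (∑ l, ∑ m, c l z * c m z) / (n : ℝ) ^ 2 := fun z => by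
      rw [div_pow, sq, Finset.sum_mul_sum]
    simp_rw [e]
    rw [integral_div, integral_finsetSum _ fun l _ => integrable_finsetSum _ fun m _ => hcci l m]
    have h1 : ∀ l, ∫ z, ∑ m, c l z * c m z ∂(Measure.pi fun _ => μ) ≤ 1 := by
      intro l
      rw [integral_finsetSum _ fun m _ => hcci l m, Finset.sum_eq_single l]
      · calc _ ≤ ∫ _ : Fin n → D, (1 : ℝ) ∂(Measure.pi fun _ => μ) :=
              integral_mono (hcci l l) (integrable_const _) fun z => (le_abs_self _).trans (hcc1 l l z)
          _ = 1 := by simp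
      · intro m _ hm
        by_cases hlk : l = k
        · simp_rw [mul_comm (c l _)]
          exact hzero m l hm (fun h => hm (h.trans hlk.symm))
        · exact hzero l m hm.symm hlk
      · simp
    calc _ ≤ (∑ _l : Fin n, (1 : ℝ)) / (n : ℝ) ^ 2 := by
          gcongr with l
          exact h1 l
      _ = 1 / n := by
        simp; field_simp
  simp_rw [hdiff]
  set s : ℝ := √n with hs
  have hs0 : 0 < s := Real.sqrt_pos.2 hn
  have hs2 : s ^ 2 = n := Real.sq_sqrt hn.le
  have hW : Measurable fun z : Fin n → D => (∑ l, c l z) / n :=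
    (Finset.measurable_sum _ fun l _ => hcm l).div_const _
  have hW1 : ∀ z, |(∑ l, c l z) / n| ≤ 1 := fun z => by
    rw [← hdiff, abs_le]
    constructor <;> linarith [ecdf_nonneg (fun l => u (z l)) (u (z k)),
      ecdf_le_one (fun l => u (z l)) (u (z k)), distFun_nonneg μ u (u (z k)),
      distFun_le_one μ hu (u (z k))]
  have hWi : Integrable (fun z : Fin n → D => ((∑ l, c l z) / n) ^ 2) (Measure.pi fun _ => μ) :=
    integrable_of_abs_le (B := 1) (hW.pow_const 2) fun z => by
      rw [abs_pow]; exact pow_le_one₀ (abs_nonneg _) (hW1 z)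
  -- The inequality `2 |x| ≤ 1 / s + s x ^ 2` with `s = √n` passes from the second moment to the
  -- first, in place of Cauchy–Schwarz.
  calc _ ≤ ∫ z, (1 / s + s * ((∑ l, c l z) / n) ^ 2) / 2 ∂(Measure.pi fun _ => μ) := by
        refine integral_mono (integrable_of_abs_le hW hW1).abs
          (((integrable_const _).add (hWi.const_mul s)).div_const 2) fun z => ?_
        simp only
        generalize (∑ l, c l z) / n = x
        rw [le_div_iff₀ two_pos]
        have : 0 ≤ (1 - s * |x|) ^ 2 / s := by positivity
        have e : (1 - s * |x|) ^ 2 / s = 1 / s + s * x ^ 2 - |x| * 2 := by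
          rw [← sq_abs x]; field_simp; ring
        linarith
    _ ≤ (1 / s + s * (1 / n)) / 2 := by
      rw [integral_div, integral_add (integrable_const _) (hWi.const_mul s), integral_const_mul]
      simp only [integral_const, probReal_univ, smul_eq_mul, one_mul]
      gcongr
    _ = 1 / s := by rw [← hs2]; field_simp; ring

lemma tendsto_const_div_sqrt_atTop (c : ℝ) :
    Tendsto (fun n : ℕ => c * (1 / √(n : ℝ))) atTop (𝓝 0) := by
  have : Tendsto (fun n : ℕ => √(n : ℝ)) atTop atTop :=
    Real.tendsto_sqrt_atTop.comp tendsto_natCast_atTop_atTop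
  simpa using (this.inv_tendsto_atTop).const_mul c

lemma integrable_abs_ecdf_sub_distFun (μ : Measure D) [IsProbabilityMeasure μ] {u : D → ℝ}
    (hu : Measurable u) (k : Fin n) :
    Integrable (fun z : Fin n → D => |ecdf (fun l => u (z l)) (u (z k)) - distFun μ u (u (z k))|)
      (Measure.pi fun _ => μ) := by
  have hu' : ∀ l : Fin n, Measurable fun z : Fin n → D => u (z l) := fun l =>
    hu.comp (measurable_pi_apply l)
  refine (integrable_of_abs_le (B := 1) ((measurable_ecdf hu' (hu' k)).sub
    ((measurable_distFun μ hu).comp (hu' k))) fun z => ?_).abs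
  rw [Pi.sub_apply, Function.comp_apply, abs_le]
  constructor <;> linarith [ecdf_nonneg (fun l => u (z l)) (u (z k)),
      ecdf_le_one (fun l => u (z l)) (u (z k)), distFun_nonneg μ u (u (z k)),
      distFun_le_one μ hu (u (z k))]

lemma integral_avg_abs_ecdf_sub_le (μ : Measure D) [IsProbabilityMeasure μ] {u : D → ℝ}
    (hu : Measurable u) (hn : 0 < n) :
    ∫ z : Fin n → D, (∑ k, |ecdf (fun l => u (z l)) (u (z k)) - distFun μ u (u (z k))|) / n
      ∂(Measure.pi fun _ => μ) ≤ 1 / √n := by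
  rw [integral_div, integral_finsetSum _ fun k _ => integrable_abs_ecdf_sub_distFun μ hu k]
  have hn' : (0 : ℝ) < n := by exact_mod_cast hn
  rw [div_le_iff₀ hn']
  calc _ ≤ ∑ _k : Fin n, 1 / √(n : ℝ) :=
        Finset.sum_le_sum fun k _ => integral_abs_ecdf_sub_distFun_le μ hu k
    _ = _ := by simp [mul_comm]

lemma abs_integral_sub_integral_le {α : Type*} [MeasurableSpace α] {P : Measure α}
    {f g h : α → ℝ} (hf : Integrable f P) (hg : Integrable g P) (hh : Integrable h P)
    (H : ∀ x, |f x - g x| ≤ h x) : |∫ x, f x ∂P - ∫ x, g x ∂P| ≤ ∫ x, h x ∂P := by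
  rw [← integral_sub hf hg]
  exact (abs_integral_le_integral_abs).trans (integral_mono (hf.sub hg).abs hh H)

lemma tendsto_integral_rankStat (j : ℕ) (μ : Measure D) [IsProbabilityMeasure μ] {u : D → ℝ}
    (hu : Measurable u) :
    Tendsto (fun n : ℕ => ∫ z : Fin n → D, rankStat j (fun l => u (z l)) ∂(Measure.pi fun _ => μ))
      atTop (𝓝 (∫ x, distFun μ u (u x) ^ j ∂μ)) := by
  rw [tendsto_iff_dist_tendsto_zero]
  refine squeeze_zero' (.of_forall fun _ => dist_nonneg) ?_ (tendsto_const_div_sqrt_atTop j)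
  filter_upwards [eventually_gt_atTop 0] with n hn
  have hn' : (0 : ℝ) < n := by exact_mod_cast hn
  have hFm : Measurable fun x => distFun μ u (u x) ^ j := ((measurable_distFun μ hu).comp hu).pow_const j
  have hF1 : ∀ x, |distFun μ u (u x) ^ j| ≤ 1 := fun x => by
    rw [abs_pow, abs_of_nonneg (distFun_nonneg _ _ _)]
    exact pow_le_one₀ (distFun_nonneg _ _ _) (distFun_le_one μ hu _)
  have hFi : ∀ k, Integrable (fun z : Fin n → D => distFun μ u (u (z k)) ^ j)
      (Measure.pi fun _ => μ) := fun k =>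
    integrable_of_abs_le (hFm.comp (measurable_pi_apply k)) fun z => hF1 (z k)
  have h1 : ∫ x, distFun μ u (u x) ^ j ∂μ = ∫ z : Fin n → D,
      (∑ k, distFun μ u (u (z k)) ^ j) / n ∂(Measure.pi fun _ => μ) := by
    rw [integral_div, integral_finsetSum _ fun k _ => hFi k]
    have : ∀ k : Fin n, ∫ z : Fin n → D, distFun μ u (u (z k)) ^ j ∂(Measure.pi fun _ => μ)
        = ∫ x, distFun μ u (u x) ^ j ∂μ := fun k => integral_pi_eval μ k hFm
    simp_rw [this]
    simp only [Finset.sum_const, Finset.card_univ, Fintype.card_fin, nsmul_eq_mul]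
    field_simp
  rw [h1, Real.dist_eq]
  have hei := fun k : Fin n => integrable_abs_ecdf_sub_distFun μ hu k
  refine (abs_integral_sub_integral_le (h := fun z : Fin n → D => j *
    ((∑ k, |ecdf (fun l => u (z l)) (u (z k)) - distFun μ u (u (z k))|) / n))
    (integrable_of_abs_le (B := 1) (measurable_rankStat j hu) fun z => ?_)
    ((integrable_finsetSum _ fun k _ => hFi k).div_const _)
    (((integrable_finsetSum _ fun k _ => hei k).div_const _).const_mul _) fun z => ?_).trans ?_
  · rw [abs_of_nonneg (rankStat_nonneg _ _)]; exact rankStat_le_one _ _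
  · rw [rankStat, ← sub_div, ← Finset.sum_sub_distrib, abs_div, Nat.abs_cast, ← mul_div_assoc,
      Finset.mul_sum]
    refine div_le_div_of_nonneg_right ((Finset.abs_sum_le_sum_abs _ _).trans
      (Finset.sum_le_sum fun k _ => ?_)) hn'.le
    exact abs_pow_sub_pow_le_mul (ecdf_nonneg _ _) (ecdf_le_one _ _) (distFun_nonneg _ _ _)
      (distFun_le_one μ hu _) j
  · rw [integral_const_mul]
    exact mul_le_mul_of_nonneg_left (integral_avg_abs_ecdf_sub_le μ hu hn) (Nat.cast_nonneg _)

end Means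

/-! ### Averages over nearest-neighbour pairs -/

/-- The average of `H` over the pairs of an index and its nearest neighbour. -/
noncomputable def nnAvg {E : Type*} [PseudoMetricSpace E] {n : ℕ} (v : Fin n → E)
    (H : Fin n → Fin n → ℝ) : ℝ :=
  (∑ k, ∑ l, nnWeight v k l * H k l) / n

section Average
variable {E : Type*} [PseudoMetricSpace E] {n : ℕ}

lemma nnAvg_mono (v : Fin n → E) {H H' : Fin n → Fin n → ℝ} (h : ∀ k l, H k l ≤ H' k l) :
    nnAvg v H ≤ nnAvg v H' :=
  div_le_div_of_nonneg_right (Finset.sum_le_sum fun k _ => Finset.sum_le_sum fun l _ =>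
    mul_le_mul_of_nonneg_left (h k l) (nnWeight_nonneg _ _ _)) (Nat.cast_nonneg _)

lemma nnAvg_add (v : Fin n → E) (H H' : Fin n → Fin n → ℝ) :
    nnAvg v (fun k l => H k l + H' k l) = nnAvg v H + nnAvg v H' := by
  simp only [nnAvg, mul_add, Finset.sum_add_distrib, add_div]

lemma nnAvg_sub (v : Fin n → E) (H H' : Fin n → Fin n → ℝ) :
    nnAvg v (fun k l => H k l - H' k l) = nnAvg v H - nnAvg v H' := by
  simp only [nnAvg, mul_sub, Finset.sum_sub_distrib, sub_div]

lemma abs_nnAvg_le (v : Fin n → E) (H : Fin n → Fin n → ℝ) :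
    |nnAvg v H| ≤ nnAvg v fun k l => |H k l| := by
  rw [nnAvg, abs_div, Nat.abs_cast]
  refine div_le_div_of_nonneg_right ((Finset.abs_sum_le_sum_abs _ _).trans
    (Finset.sum_le_sum fun k _ => (Finset.abs_sum_le_sum_abs _ _).trans
    (Finset.sum_le_sum fun l _ => ?_))) (Nat.cast_nonneg _)
  rw [abs_mul, abs_of_nonneg (nnWeight_nonneg _ _ _)]

lemma abs_nnAvg_le_of_abs_le (v : Fin n → E) {H : Fin n → Fin n → ℝ} {B : ℝ} (hB : 0 ≤ B)
    (h : ∀ k l, |H k l| ≤ B) : |nnAvg v H| ≤ B := by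
  refine (abs_nnAvg_le v H).trans (div_le_of_le_mul₀ (Nat.cast_nonneg _) hB ?_)
  calc _ ≤ ∑ k, (∑ l, nnWeight v k l) * B := Finset.sum_le_sum fun k _ => by
        rw [Finset.sum_mul]
        exact Finset.sum_le_sum fun l _ => mul_le_mul_of_nonneg_left (h k l) (nnWeight_nonneg _ _ _)
    _ ≤ ∑ _k : Fin n, 1 * B := Finset.sum_le_sum fun k _ =>
        mul_le_mul_of_nonneg_right (sum_nnWeight_le_one v k) hB
    _ = B * n := by simp [mul_comm]

lemma nnAvg_left (hn : 2 ≤ n) (v : Fin n → E) (h : Fin n → ℝ) :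
    nnAvg v (fun k _ => h k) = (∑ k, h k) / n := by
  simp only [nnAvg, ← Finset.sum_mul, sum_nnWeight hn, one_mul]

lemma nnAvg_left_le (v : Fin n → E) {h : Fin n → ℝ} (h0 : ∀ k, 0 ≤ h k) :
    nnAvg v (fun k _ => h k) ≤ (∑ k, h k) / n := by
  simp only [nnAvg, ← Finset.sum_mul]
  exact div_le_div_of_nonneg_right (Finset.sum_le_sum fun k _ =>
    mul_le_of_le_one_left (h0 k) (sum_nnWeight_le_one v k)) (Nat.cast_nonneg _)

/-- Exchanging the sums exposes the total weight received by each index. This is what transfers an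
average error at sample points to an average error at their neighbours. -/
lemma nnAvg_right_le {K : ℝ} (hK : ∀ (v : Fin n → E) (i : Fin n), ∑ k, nnWeight v k i ≤ K)
    (v : Fin n → E) {h : Fin n → ℝ} (h0 : ∀ k, 0 ≤ h k) :
    nnAvg v (fun _ l => h l) ≤ K * ((∑ k, h k) / n) := by
  rw [nnAvg, Finset.sum_comm, ← mul_div_assoc, Finset.mul_sum]
  simp only [← Finset.sum_mul]
  exact div_le_div_of_nonneg_right (Finset.sum_le_sum fun k _ =>
    mul_le_mul_of_nonneg_right (hK v k) (h0 k)) (Nat.cast_nonneg _)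

lemma measurable_nnAvg {D : Type*} [MeasurableSpace D] [MeasurableSpace E]
    [OpensMeasurableSpace E] [SecondCountableTopology E] {v : D → E} (hv : Measurable v)
    {α : Type*} [MeasurableSpace α] {ζ : α → Fin n → D} (hζ : Measurable ζ)
    {H : α → Fin n → Fin n → ℝ} (hH : ∀ k l, Measurable fun z => H z k l) :
    Measurable fun z : α => nnAvg (fun l => v (ζ z l)) (H z) := by
  refine (Finset.measurable_sum _ fun k _ => Finset.measurable_sum _ fun l _ => ?_).div_const _
  exact ((measurable_nnWeight k l).comp
    (measurable_pi_lambda _ fun i => hv.comp ((measurable_pi_apply i).comp hζ))).mul (hH k l)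

end Average

/-! ### Oscillation of uniformly continuous functions between neighbours -/

section Oscillation
variable {E : Type*} [NormedAddCommGroup E] {n : ℕ}

open scoped Classical in
/-- The nearest-neighbour oscillation of a uniformly continuous function. -/
lemma nnAvg_abs_sub_le (v : Fin n → E) {φ : E → ℝ} {M η δ R : ℝ} {m : ℕ} (hM : 0 ≤ M)
    (hη : 0 ≤ η) (hφ : ∀ x, |φ x| ≤ M) (hφδ : ∀ x y, dist x y < δ → |φ y - φ x| ≤ η)
    (hm : ∀ s : Finset (Fin n), (∀ k ∈ s, ‖v k‖ ≤ R ∧ ∃ l ∈ nearestIdx v k, δ ≤ dist (v k) (v l)) →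
      s.card ≤ m) :
    nnAvg v (fun k l => |φ (v l) - φ (v k)|)
      ≤ η + 2 * M * ((∑ k, if R < ‖v k‖ then 1 else 0) / n) + 2 * M * (m / n) := by
  have hn : (0 : ℝ) ≤ n := Nat.cast_nonneg _
  set s := Finset.univ.filter fun k => ‖v k‖ ≤ R ∧ ∃ l ∈ nearestIdx v k, δ ≤ dist (v k) (v l)
    with hs
  have h2M : ∀ x y, |φ x - φ y| ≤ 2 * M := fun x y => (abs_sub _ _).trans (by linarith [hφ x, hφ y])
  -- Rows outside the ball of radius `R`, and rows in the ball with a neighbour at distance at least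
  -- `δ`, are bounded trivially by `2 * M`. In all other rows every neighbour is within `δ`, and
  -- uniform continuity applies.
  have hrow : ∀ k, ∑ l, nnWeight v k l * |φ (v l) - φ (v k)|
      ≤ η + 2 * M * (if R < ‖v k‖ then 1 else 0) + 2 * M * (if k ∈ s then 1 else 0) := by
    intro k
    rw [sum_nnWeight_mul]
    have hbd : ∀ B : ℝ, 0 ≤ B → (∀ l ∈ nearestIdx v k, |φ (v l) - φ (v k)| ≤ B) →
        finAvg (nearestIdx v k) (fun l => |φ (v l) - φ (v k)|) ≤ B := by
      intro B hB h
      have := abs_finAvg_sub_le (nearestIdx v k) (h := fun l => |φ (v l) - φ (v k)|)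
        (h' := fun _ => 0) hB fun l hl => by simpa using h l hl
      have h0 : finAvg (nearestIdx v k) (fun _ => (0 : ℝ)) = 0 := by simp [finAvg]
      rw [h0, sub_zero] at this
      exact (le_abs_self _).trans this
    by_cases h1 : R < ‖v k‖
    · refine (hbd (2 * M) (by linarith) fun l _ => h2M _ _).trans ?_
      simp only [h1, if_true]
      have : 0 ≤ 2 * M * (if k ∈ s then (1 : ℝ) else 0) := by positivity
      linarith
    · by_cases h2 : k ∈ s
      · refine (hbd (2 * M) (by linarith) fun l _ => h2M _ _).trans ?_
        simp only [h1, h2, if_true, if_false]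
        linarith
      · refine (hbd η hη fun l hl => hφδ _ _ ?_).trans (by simp [h1, h2])
        by_contra hd
        exact h2 (by simpa [hs] using ⟨not_lt.1 h1, l, hl, not_lt.1 hd⟩)
  have hsm : (s.card : ℝ) ≤ m := by
    exact_mod_cast hm s fun k hk => by simpa [hs] using hk
  calc _ ≤ (∑ k, (η + 2 * M * (if R < ‖v k‖ then 1 else 0)
          + 2 * M * (if k ∈ s then 1 else 0))) / n :=
        div_le_div_of_nonneg_right (Finset.sum_le_sum fun k _ => hrow k) hn
    _ = η * (n / n) + 2 * M * ((∑ k, if R < ‖v k‖ then 1 else 0) / n)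
          + 2 * M * (s.card / n) := by
      rw [Finset.sum_add_distrib, Finset.sum_add_distrib, ← Finset.mul_sum, ← Finset.mul_sum]
      have : ∑ k, (if k ∈ s then (1 : ℝ) else 0) = s.card := by simp
      rw [this]
      simp only [Finset.sum_const, Finset.card_univ, Fintype.card_fin, nsmul_eq_mul]
      ring
    _ ≤ _ := by
      gcongr
      exact mul_le_of_le_one_right hη (div_self_le_one _)

end Oscillation

/-! ### Measurable functions at a point and at its neighbour -/

section NeighbourMeans
variable {D : Type*} [MeasurableSpace D]
  {E : Type*} [NormedAddCommGroup E] [NormedSpace ℝ E] [ProperSpace E] [MeasurableSpace E]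
  [BorelSpace E]

lemma integral_avg_pi (μ : Measure D) [IsProbabilityMeasure μ] {n : ℕ} (hn : 0 < n) {f : D → ℝ}
    (hf : Measurable f) {B : ℝ} (hB : ∀ x, |f x| ≤ B) :
    ∫ z : Fin n → D, (∑ k, f (z k)) / n ∂(Measure.pi fun _ => μ) = ∫ x, f x ∂μ := by
  have hi : ∀ k, Integrable (fun z : Fin n → D => f (z k)) (Measure.pi fun _ => μ) := fun k =>
    integrable_of_abs_le (hf.comp (measurable_pi_apply k)) fun z => hB (z k)
  rw [integral_div, integral_finsetSum _ fun k _ => hi k]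
  simp_rw [integral_pi_eval μ _ hf]
  have : (n : ℝ) ≠ 0 := by exact_mod_cast hn.ne'
  simp only [Finset.sum_const, Finset.card_univ, Fintype.card_fin, nsmul_eq_mul]
  field_simp

lemma integrable_avg_pi (μ : Measure D) [IsProbabilityMeasure μ] {n : ℕ} {f : D → ℝ}
    (hf : Measurable f) {B : ℝ} (hB : ∀ x, |f x| ≤ B) :
    Integrable (fun z : Fin n → D => (∑ k, f (z k)) / n) (Measure.pi fun _ => μ) :=
  (integrable_finsetSum _ fun k _ =>
    integrable_of_abs_le (hf.comp (measurable_pi_apply k)) fun z => hB (z k)).div_const _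

/-- Values of a measurable function at a point and at its nearest neighbour are close on average. -/
lemma tendsto_integral_nnAvg_abs_sub (μ : Measure D) [IsProbabilityMeasure μ] {v : D → E}
    (hv : Measurable v) {g : E → ℝ} (hg : Measurable g) (hg1 : ∀ x, |g x| ≤ 1) :
    Tendsto (fun n : ℕ => ∫ z : Fin n → D, nnAvg (fun l => v (z l))
      (fun k l => |g (v (z l)) - g (v (z k))|) ∂(Measure.pi fun _ => μ)) atTop (𝓝 0) := by
  obtain ⟨K, hK0, hK⟩ := exists_sum_nnWeight_le E
  set ν := μ.map v with hν
  have : IsProbabilityMeasure ν := Measure.isProbabilityMeasure_map hv.aemeasurable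
  rw [Metric.tendsto_nhds]
  intro ε hε
  set η := ε / (K + 5) with hη
  have hη0 : 0 < η := by positivity
  obtain ⟨φ, hφc, hφη, hφcont, -⟩ := (integrable_of_abs_le (μ := ν) hg
    hg1).exists_hasCompactSupport_integral_sub_le hη0
  obtain ⟨M, hM⟩ := hφc.exists_bound_of_continuous hφcont
  simp only [Real.norm_eq_abs] at hM
  have hM0 : 0 ≤ M := (abs_nonneg _).trans (hM 0)
  have huc := hφc.uniformContinuous_of_continuous hφcont
  obtain ⟨δ, hδ, hφδ⟩ := Metric.uniformContinuous_iff.1 huc η hη0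
  have htight := isTightMeasureSet_singleton (μ := ν)
  -- The tail mass is later multiplied by `2 * M`; the extra `1` in the denominator covers `M = 0`.
  obtain ⟨C, hC, hCν⟩ := isTightMeasureSet_iff_exists_isCompact_measure_compl_le.1 htight
    (ENNReal.ofReal (η / (2 * M + 1))) (by simpa using by positivity)
  obtain ⟨R, hR⟩ := hC.isBounded.exists_norm_le
  obtain ⟨m, hm⟩ := exists_card_isolated_le (E := E) R hδ
  have hmeasR : MeasurableSet {x : D | R < ‖v x‖} := measurableSet_lt measurable_const hv.norm
  have hRμ : μ.real {x : D | R < ‖v x‖} ≤ η / (2 * M + 1) := by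
    have h1 : μ {x : D | R < ‖v x‖} ≤ ν Cᶜ := by
      rw [hν, Measure.map_apply hv hC.measurableSet.compl]
      refine measure_mono fun x hx hxC => ?_
      exact absurd (hR _ hxC) (not_le.2 hx)
    exact ENNReal.toReal_le_of_le_ofReal (by positivity) (h1.trans (hCν ν rfl))
  have hlim : Tendsto (fun n : ℕ => 2 * M * ((m : ℝ) / n)) atTop (𝓝 0) := by
    simpa using (tendsto_const_div_atTop_nhds_zero_nat (m : ℝ)).const_mul (2 * M)
  filter_upwards [eventually_ge_atTop 2, hlim.eventually (gt_mem_nhds hη0)] with n hn hmn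
  have hn0 : 0 < n := by omega
  set f : D → ℝ := fun x => |g (v x) - φ (v x)| with hf
  have hfm : Measurable f := ((hg.comp hv).sub (hφcont.measurable.comp hv)).abs
  have hf0 : ∀ x, 0 ≤ f x := fun x => abs_nonneg _
  have hfB : ∀ x, |f x| ≤ 1 + M := fun x => by
    rw [hf]; simp only [abs_abs]
    exact (abs_sub _ _).trans (add_le_add (hg1 _) (hM _))
  have hfint : ∫ x, f x ∂μ ≤ η := by
    have hm : Measurable fun e => ‖g e - φ e‖ := (hg.sub hφcont.measurable).norm
    rwa [hν, integral_map hv.aemeasurable hm.aestronglyMeasurable] at hφη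
  set χ : D → ℝ := fun x => if R < ‖v x‖ then 1 else 0 with hχ
  have hχm : Measurable χ := Measurable.ite hmeasR measurable_const measurable_const
  have hχ1 : ∀ x, |χ x| ≤ 1 := fun x => by simp only [hχ]; split_ifs <;> norm_num
  have hχint : ∫ x, χ x ∂μ ≤ η / (2 * M + 1) := by
    refine le_trans (le_of_eq ?_) hRμ
    have : χ = {x : D | R < ‖v x‖}.indicator fun _ => (1 : ℝ) := by
      funext x; simp [hχ, Set.indicator_apply]
    rw [this, integral_indicator_const _ hmeasR]; simp
  have hpt : ∀ z : Fin n → D, nnAvg (fun l => v (z l)) (fun k l => |g (v (z l)) - g (v (z k))|)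
      ≤ (K + 1) * ((∑ k, f (z k)) / n) + 2 * M * ((∑ k, χ (z k)) / n) + (η + 2 * M * (m / n)) := by
    intro z
    have h1 : nnAvg (fun l => v (z l)) (fun k l => |g (v (z l)) - g (v (z k))|)
        ≤ nnAvg (fun l => v (z l)) (fun k l => (f (z l) + f (z k)) + |φ (v (z l)) - φ (v (z k))|) :=
      nnAvg_mono _ fun k l => by
        have e : g (v (z l)) - g (v (z k)) = (g (v (z l)) - φ (v (z l)))
          - (g (v (z k)) - φ (v (z k))) + (φ (v (z l)) - φ (v (z k))) := by ring
        rw [e]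
        exact (abs_add_le _ _).trans (add_le_add (abs_sub _ _) le_rfl)
    refine h1.trans ?_
    rw [nnAvg_add, nnAvg_add]
    have b1 := nnAvg_right_le (hK n) (fun l => v (z l)) fun k => hf0 (z k)
    have b2 := nnAvg_left_le (fun l => v (z l)) fun k => hf0 (z k)
    have b3 := nnAvg_abs_sub_le (fun l => v (z l)) hM0 hη0.le hM (fun x y hxy => by
      have := hφδ hxy
      rw [Real.dist_eq, abs_sub_comm] at this
      exact this.le) (hm n _)
    linarith
  have hfi := integrable_avg_pi μ (n := n) hfm hfB
  have hχi := integrable_avg_pi μ (n := n) hχm hχ1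
  have hbound : ∫ z : Fin n → D, nnAvg (fun l => v (z l)) (fun k l => |g (v (z l)) - g (v (z k))|)
      ∂(Measure.pi fun _ => μ) ≤ K * η + η + (η + η + 2 * M * (m / n)) := by
    have hi1 : Integrable (fun z : Fin n → D => (K + 1) * ((∑ k, f (z k)) / n))
      (Measure.pi fun _ => μ) := hfi.const_mul _
    have hi2 : Integrable (fun z : Fin n → D => 2 * M * ((∑ k, χ (z k)) / n))
      (Measure.pi fun _ => μ) := hχi.const_mul _
    have hi3 : Integrable (fun z : Fin n → D => (K + 1) * ((∑ k, f (z k)) / n)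
      + 2 * M * ((∑ k, χ (z k)) / n)) (Measure.pi fun _ => μ) := hi1.add hi2
    calc _ ≤ ∫ z : Fin n → D, ((K + 1) * ((∑ k, f (z k)) / n) + 2 * M * ((∑ k, χ (z k)) / n)
          + (η + 2 * M * (m / n))) ∂(Measure.pi fun _ => μ) := by
          refine integral_mono_of_nonneg (ae_of_all _ fun z => ?_)
            (hi3.add (integrable_const _)) (ae_of_all _ hpt)
          exact div_nonneg (Finset.sum_nonneg fun k _ => Finset.sum_nonneg fun l _ =>
            mul_nonneg (nnWeight_nonneg _ _ _) (abs_nonneg _)) (Nat.cast_nonneg _)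
      _ = (K + 1) * ∫ x, f x ∂μ + 2 * M * ∫ x, χ x ∂μ + (η + 2 * M * (m / n)) := by
          rw [integral_add hi3 (integrable_const _), integral_add hi1 hi2,
            integral_const_mul, integral_const_mul, integral_avg_pi μ hn0 hfm hfB,
            integral_avg_pi μ hn0 hχm hχ1]
          simp
      _ ≤ _ := by
          have : 2 * M * ∫ x, χ x ∂μ ≤ η := by
            calc 2 * M * ∫ x, χ x ∂μ ≤ 2 * M * (η / (2 * M + 1)) := by gcongr
              _ = η * (2 * M / (2 * M + 1)) := by ring
              _ ≤ η * 1 := by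
                gcongr
                exact div_le_one_of_le₀ (by linarith) (by linarith)
              _ = η := mul_one _
          have : (K + 1) * ∫ x, f x ∂μ ≤ (K + 1) * η := by gcongr
          linarith
  have h0 : 0 ≤ ∫ z : Fin n → D, nnAvg (fun l => v (z l))
      (fun k l => |g (v (z l)) - g (v (z k))|) ∂(Measure.pi fun _ => μ) :=
    integral_nonneg fun z => div_nonneg (Finset.sum_nonneg fun k _ => Finset.sum_nonneg fun l _ =>
            mul_nonneg (nnWeight_nonneg _ _ _) (abs_nonneg _)) (Nat.cast_nonneg _)
  rw [Real.dist_eq, sub_zero, abs_of_nonneg h0]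
  have : (K + 5) * η = ε := by rw [hη]; field_simp
  linarith

end NeighbourMeans

/-! ### Threshold indicators -/

section UpperIndicator
variable {D : Type*}

/-- The indicator function of `{x | y ≤ u x}`. -/
noncomputable def upperInd (u : D → ℝ) (y : ℝ) (x : D) : ℝ := if y ≤ u x then 1 else 0

lemma abs_upperInd_le_one (u : D → ℝ) (y : ℝ) (x : D) : |upperInd u y x| ≤ 1 := by
  unfold upperInd; split_ifs <;> norm_num

lemma abs_upperInd_mul_le_one (u : D → ℝ) (y : ℝ) (x x' : D) :
    |upperInd u y x * upperInd u y x'| ≤ 1 := by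
  rw [abs_mul]
  exact mul_le_one₀ (abs_upperInd_le_one _ _ _) (abs_nonneg _) (abs_upperInd_le_one _ _ _)

lemma abs_nnAvg_upperInd_le_one {E : Type*} [PseudoMetricSpace E] {n : ℕ} (v : Fin n → E)
    (u : D → ℝ) (y : ℝ) (z : Fin n → D) :
    |nnAvg v (fun k l => upperInd u y (z k) * upperInd u y (z l))| ≤ 1 :=
  abs_nnAvg_le_of_abs_le _ zero_le_one fun k l => abs_upperInd_mul_le_one u y (z k) (z l)

variable [MeasurableSpace D]

lemma measurable_upperInd {α : Type*} [MeasurableSpace α] {u : D → ℝ} (hu : Measurable u)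
    {y : α → ℝ} (hy : Measurable y) {x : α → D} (hx : Measurable x) :
    Measurable fun a => upperInd u (y a) (x a) :=
  Measurable.ite (measurableSet_le hy (hu.comp hx)) measurable_const measurable_const

/-- A minimum exceeds a threshold iff both values do. Drawing the threshold from the law of `u`
turns the distribution function at a minimum into an average of products, to which conditional
expectations given the predictors can be applied. -/
lemma integral_upperInd_mul (μ : Measure D) (u : D → ℝ) (x x' : D) :
    ∫ d, upperInd u (u d) x * upperInd u (u d) x' ∂μ = distFun μ u (min (u x) (u x')) := by
  rw [distFun]
  refine integral_congr_ae (ae_of_all _ fun d => ?_)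
  simp only [upperInd, le_min_iff, ite_and, ite_mul, one_mul, zero_mul]

lemma integral_nnAvg_upperInd (μ : Measure D) [IsProbabilityMeasure μ] {u : D → ℝ}
    (hu : Measurable u) {E : Type*} [PseudoMetricSpace E] {n : ℕ} (v : Fin n → E) (z : Fin n → D) :
    ∫ d, nnAvg v (fun k l => upperInd u (u d) (z k) * upperInd u (u d) (z l)) ∂μ
      = nnAvg v (fun k l => distFun μ u (min (u (z k)) (u (z l)))) := by
  have hi : ∀ k l : Fin n, Integrable (fun d => nnWeight v k l *
      (upperInd u (u d) (z k) * upperInd u (u d) (z l))) μ := fun k l =>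
    (integrable_of_abs_le ((measurable_upperInd hu hu measurable_const).mul
      (measurable_upperInd hu hu measurable_const))
      fun d => abs_upperInd_mul_le_one u (u d) (z k) (z l)).const_mul _
  simp only [nnAvg]
  rw [integral_div, integral_finsetSum _ fun k _ => integrable_finsetSum _ fun l _ => hi k l]
  congr 1
  refine Finset.sum_congr rfl fun k _ => ?_
  rw [integral_finsetSum _ fun l _ => hi k l]
  refine Finset.sum_congr rfl fun l _ => ?_
  rw [integral_const_mul, integral_upperInd_mul]

end UpperIndicator

/-! ### Limit of the mean of the nearest-neighbour statistic -/

section NeighbourLimits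
variable {D : Type*} [MeasurableSpace D]
  {E : Type*} [NormedAddCommGroup E] [ProperSpace E] [MeasurableSpace E] [BorelSpace E]

/-- Responses may be replaced by their conditional means given the predictors. -/
lemma integral_nnAvg_mul_eq (μ : Measure D) [IsProbabilityMeasure μ] {v : D → E}
    (hv : Measurable v) {a : D → ℝ} (ha : Measurable a) (ha1 : ∀ x, |a x| ≤ 1) {g : E → ℝ}
    (hg : Measurable g) (hg1 : ∀ x, |g x| ≤ 1)
    (hag : ∀ φ : E → ℝ, Measurable φ → (∀ e, |φ e| ≤ 1) →
      ∫ x, a x * φ (v x) ∂μ = ∫ x, g (v x) * φ (v x) ∂μ) (n : ℕ) :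
    ∫ z : Fin n → D, nnAvg (fun l => v (z l)) (fun k l => a (z k) * a (z l))
        ∂(Measure.pi fun _ => μ)
      = ∫ z : Fin n → D, nnAvg (fun l => v (z l)) (fun k l => g (v (z k)) * g (v (z l)))
        ∂(Measure.pi fun _ => μ) := by
  have hgv : Measurable fun x => g (v x) := hg.comp hv
  have hgv1 : ∀ x, |g (v x)| ≤ 1 := fun x => hg1 (v x)
  have hwm : ∀ k l, Measurable fun z : Fin n → D => nnWeight (fun i => v (z i)) k l := fun k l =>
    (measurable_nnWeight k l).comp (measurable_pi_lambda _ fun i => hv.comp (measurable_pi_apply i))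
  have hw1 : ∀ (z : Fin n → D) k l, |nnWeight (fun i => v (z i)) k l| ≤ 1 := fun z k l => by
    rw [abs_of_nonneg (nnWeight_nonneg _ _ _)]; exact nnWeight_le_one _ _ _
  have hΦ1 : ∀ (b : D → ℝ), (∀ x, |b x| ≤ 1) → ∀ k l i (z : Fin n → D),
      |nnWeight (fun i => v (z i)) k l * b (z i)| ≤ 1 := fun b hb k l i z => by
    rw [abs_mul]; exact mul_le_one₀ (hw1 z k l) (abs_nonneg _) (hb _)
  have hupd : ∀ (z : Fin n → D) k x, (fun i => v (Function.update z k x i))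
      = Function.update (fun i => v (z i)) k (v x) := fun z k x => by
    funext i
    by_cases hi : i = k
    · subst hi; simp
    · simp [hi]
  have hdep : ∀ (b : D → ℝ), (∀ x, |b x| ≤ 1) → ∀ k l i j : Fin n, i ≠ j → ∀ z : Fin n → D,
      ∃ φ : E → ℝ, Measurable φ ∧ (∀ e, |φ e| ≤ 1) ∧ ∀ x,
        nnWeight (fun m => v (Function.update z i x m)) k l * b (Function.update z i x j)
          = φ (v x) := by
    intro b hb k l i j hij z
    refine ⟨fun e => nnWeight (Function.update (fun m => v (z m)) i e) k l * b (z j), ?_, ?_, ?_⟩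
    · exact ((measurable_nnWeight k l).comp (measurable_update _)).mul_const _
    · intro e
      rw [abs_mul, abs_of_nonneg (nnWeight_nonneg _ _ _)]
      exact mul_le_one₀ (nnWeight_le_one _ _ _) (abs_nonneg _) (hb _)
    · intro x
      rw [hupd, Function.update_of_ne hij.symm]
  -- The weights depend on the sample only through the predictors. For `k ≠ l` the response can
  -- therefore be replaced by its conditional mean first at coordinate `k`, then at `l`; for `k = l`
  -- the weight vanishes.
  have hstep : ∀ k l, ∫ z : Fin n → D, nnWeight (fun i => v (z i)) k l * (a (z k) * a (z l))
        ∂(Measure.pi fun _ => μ)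
      = ∫ z : Fin n → D, nnWeight (fun i => v (z i)) k l * (g (v (z k)) * g (v (z l)))
        ∂(Measure.pi fun _ => μ) := by
    intro k l
    by_cases hkl : k = l
    · subst hkl; simp [nnWeight_self]
    have h1 := integral_mul_eq_of_condExp_eq μ ha hgv ha1 hgv1 hag k
      (Φ := fun z : Fin n → D => nnWeight (fun i => v (z i)) k l * a (z l))
      ((hwm k l).mul (ha.comp (measurable_pi_apply l))) (hΦ1 a ha1 k l l) (hdep a ha1 k l k l hkl)
    have h2 := integral_mul_eq_of_condExp_eq μ ha hgv ha1 hgv1 hag l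
      (Φ := fun z : Fin n → D => nnWeight (fun i => v (z i)) k l * g (v (z k)))
      ((hwm k l).mul (hgv.comp (measurable_pi_apply k))) (hΦ1 _ hgv1 k l k) (hdep _ hgv1 k l l k (Ne.symm hkl))
    calc _ = ∫ z : Fin n → D, a (z k) * (nnWeight (fun i => v (z i)) k l * a (z l))
            ∂(Measure.pi fun _ => μ) := integral_congr_ae (ae_of_all _ fun z => by
              simp only; ring)
      _ = _ := h1
      _ = ∫ z : Fin n → D, a (z l) * (nnWeight (fun i => v (z i)) k l * g (v (z k)))
            ∂(Measure.pi fun _ => μ) := integral_congr_ae (ae_of_all _ fun z => by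
              simp only; ring)
      _ = _ := h2
      _ = _ := integral_congr_ae (ae_of_all _ fun z => by simp only; ring)
  have hint : ∀ b : D → ℝ, Measurable b → (∀ x, |b x| ≤ 1) → ∀ k l,
      Integrable (fun z : Fin n → D => nnWeight (fun i => v (z i)) k l * (b (z k) * b (z l)))
        (Measure.pi fun _ => μ) := by
    intro b hb hb1 k l
    refine integrable_of_abs_le (B := 1) ((hwm k l).mul ((hb.comp (measurable_pi_apply k)).mul
      (hb.comp (measurable_pi_apply l)))) fun z => ?_
    rw [← mul_assoc, abs_mul]
    exact mul_le_one₀ (hΦ1 b hb1 k l k z) (abs_nonneg _) (hb1 _)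
  simp only [nnAvg]
  rw [integral_div, integral_div,
    integral_finsetSum _ fun k _ => integrable_finsetSum _ fun l _ => hint a ha ha1 k l,
    integral_finsetSum _ fun k _ => integrable_finsetSum _ fun l _ => hint _ hgv hgv1 k l]
  congr 1
  refine Finset.sum_congr rfl fun k _ => ?_
  rw [integral_finsetSum _ fun l _ => hint a ha ha1 k l,
    integral_finsetSum _ fun l _ => hint _ hgv hgv1 k l]
  exact Finset.sum_congr rfl fun l _ => hstep k l

lemma measurable_nnAvg_upperInd {α : Type*} [MeasurableSpace α] {n : ℕ} {v : D → E}
    (hv : Measurable v) {u : D → ℝ} (hu : Measurable u) {y : α → ℝ} (hy : Measurable y)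
    {ζ : α → Fin n → D} (hζ : Measurable ζ) : Measurable fun p : α =>
      nnAvg (fun l => v (ζ p l)) (fun k l => upperInd u (y p) (ζ p k) * upperInd u (y p) (ζ p l)) := by
  have h1 : ∀ k : Fin n, Measurable fun p : α => upperInd u (y p) (ζ p k) := fun k =>
    measurable_upperInd hu hy ((measurable_pi_apply k).comp hζ)
  exact measurable_nnAvg hv hζ fun k l => (h1 k).mul (h1 l)

lemma integral_integral_nnAvg_upperInd (μ : Measure D) [IsProbabilityMeasure μ] {v : D → E}
    (hv : Measurable v) {u : D → ℝ} (hu : Measurable u) (n : ℕ) :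
    ∫ d, ∫ z : Fin n → D, nnAvg (fun l => v (z l))
      (fun k l => upperInd u (u d) (z k) * upperInd u (u d) (z l)) ∂(Measure.pi fun _ => μ) ∂μ
      = ∫ z : Fin n → D, nnAvg (fun l => v (z l))
      (fun k l => distFun μ u (min (u (z k)) (u (z l)))) ∂(Measure.pi fun _ => μ) := by
  have hint : Integrable (Function.uncurry fun (d : D) (z : Fin n → D) => nnAvg (fun l => v (z l))
      (fun k l => upperInd u (u d) (z k) * upperInd u (u d) (z l)))
      (μ.prod (Measure.pi fun _ => μ)) := by
    have hm : Measurable fun p : D × (Fin n → D) => nnAvg (fun l => v (p.2 l))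
        (fun k l => upperInd u (u p.1) (p.2 k) * upperInd u (u p.1) (p.2 l)) :=
      measurable_nnAvg_upperInd hv hu (hu.comp measurable_fst) measurable_snd
    exact integrable_of_abs_le hm fun p => abs_nnAvg_upperInd_le_one _ u (u p.1) p.2
  rw [integral_integral_swap hint]
  exact integral_congr_ae (ae_of_all _ fun z => integral_nnAvg_upperInd μ hu _ z)

/-- The minimum of two responses is one of the two, so only errors of the empirical distribution
function at sample points occur. Errors at the row index cost a factor `1`, and errors at the
neighbour cost a factor `K`. -/
lemma abs_integral_nnStat_sub_le (μ : Measure D) [IsProbabilityMeasure μ] {v : D → E}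
    (hv : Measurable v) {u : D → ℝ} (hu : Measurable u) {n : ℕ} (hn : 0 < n) {K : ℝ} (hK0 : 0 ≤ K)
    (hK : ∀ (v : Fin n → E) (i : Fin n), ∑ k, nnWeight v k i ≤ K) :
    |∫ z : Fin n → D, nnStat (fun l => v (z l)) (fun l => u (z l)) ∂(Measure.pi fun _ => μ)
      - ∫ z : Fin n → D, nnAvg (fun l => v (z l))
      (fun k l => distFun μ u (min (u (z k)) (u (z l)))) ∂(Measure.pi fun _ => μ)|
      ≤ (1 + K) * (1 / √n) := by
  have hu' : ∀ l : Fin n, Measurable fun z : Fin n → D => u (z l) := fun l =>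
    hu.comp (measurable_pi_apply l)
  have hei := fun k : Fin n => integrable_abs_ecdf_sub_distFun μ hu k
  have hdm : Measurable fun z : Fin n → D => nnAvg (fun l => v (z l))
      (fun k l => distFun μ u (min (u (z k)) (u (z l)))) :=
    measurable_nnAvg hv measurable_id fun k l =>
      (measurable_distFun μ hu).comp ((hu' k).min (hu' l))
  refine (abs_integral_sub_integral_le (h := fun z : Fin n → D => (1 + K) *
    ((∑ k, |ecdf (fun l => u (z l)) (u (z k)) - distFun μ u (u (z k))|) / n))
    (integrable_of_abs_le (B := 1) (measurable_nnStat hv hu) fun z => ?_)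
    (integrable_of_abs_le (B := 1) hdm fun z => ?_)
    (((integrable_finsetSum _ fun k _ => hei k).div_const _).const_mul _) fun z => ?_).trans ?_
  · rw [abs_of_nonneg (nnStat_nonneg _ _)]; exact nnStat_le_one _ _
  · refine abs_nnAvg_le_of_abs_le _ zero_le_one fun k l => ?_
    rw [abs_of_nonneg (distFun_nonneg _ _ _)]
    exact distFun_le_one μ hu _
  · set e : Fin n → ℝ := fun k => |ecdf (fun l => u (z l)) (u (z k)) - distFun μ u (u (z k))|
      with he
    have he0 : ∀ k, 0 ≤ e k := fun k => abs_nonneg _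
    change |nnAvg (fun l => v (z l)) (fun k l => ecdf (fun l => u (z l)) (min (u (z k)) (u (z l))))
      - nnAvg (fun l => v (z l)) (fun k l => distFun μ u (min (u (z k)) (u (z l))))| ≤ _
    rw [← nnAvg_sub, add_mul, one_mul]
    refine (abs_nnAvg_le _ _).trans ?_
    calc _ ≤ nnAvg (fun l => v (z l)) (fun k l => e k + e l) := nnAvg_mono _ fun k l => by
          rcases min_choice (u (z k)) (u (z l)) with h | h <;> rw [h]
          · exact le_add_of_nonneg_right (he0 l)
          · exact le_add_of_nonneg_left (he0 k)
      _ ≤ _ := by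
        rw [nnAvg_add]
        exact add_le_add (nnAvg_left_le _ he0) (nnAvg_right_le hK _ he0)
  · rw [integral_const_mul]
    exact mul_le_mul_of_nonneg_left (integral_avg_abs_ecdf_sub_le μ hu hn) (by linarith)

variable [NormedSpace ℝ E]

/-- Once `a` is replaced by its conditional mean `g ∘ v`, the value of `g` at the neighbour may be
replaced by its value at the point itself, and the pair product becomes a square. -/
lemma tendsto_integral_nnAvg_mul (μ : Measure D) [IsProbabilityMeasure μ] {v : D → E}
    (hv : Measurable v) {a : D → ℝ} (ha : Measurable a) (ha1 : ∀ x, |a x| ≤ 1) {g : E → ℝ}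
    (hg : Measurable g) (hg1 : ∀ x, |g x| ≤ 1)
    (hag : ∀ φ : E → ℝ, Measurable φ → (∀ e, |φ e| ≤ 1) →
      ∫ x, a x * φ (v x) ∂μ = ∫ x, g (v x) * φ (v x) ∂μ) :
    Tendsto (fun n : ℕ => ∫ z : Fin n → D, nnAvg (fun l => v (z l))
      (fun k l => a (z k) * a (z l)) ∂(Measure.pi fun _ => μ)) atTop
      (𝓝 (∫ x, g (v x) ^ 2 ∂μ)) := by
  simp_rw [integral_nnAvg_mul_eq μ hv ha ha1 hg hg1 hag]
  rw [tendsto_iff_dist_tendsto_zero]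
  refine squeeze_zero' (.of_forall fun _ => dist_nonneg) ?_
    (tendsto_integral_nnAvg_abs_sub μ hv hg hg1)
  filter_upwards [eventually_ge_atTop 2] with n hn
  have hgv : Measurable fun x => g (v x) := hg.comp hv
  have hg2 : ∀ x, |g (v x) ^ 2| ≤ 1 := fun x => by
    rw [abs_pow]; exact pow_le_one₀ (abs_nonneg _) (hg1 _)
  have hgk : ∀ k : Fin n, Measurable fun z : Fin n → D => g (v (z k)) := fun k =>
    hgv.comp (measurable_pi_apply k)
  rw [← integral_avg_pi μ (show 0 < n by omega) (hgv.pow_const 2) hg2, Real.dist_eq]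
  refine abs_integral_sub_integral_le
    (integrable_of_abs_le (B := 1) (measurable_nnAvg hv measurable_id fun k l =>
      (hgk k).mul (hgk l)) fun z => ?_)
    (integrable_avg_pi μ (hgv.pow_const 2) hg2)
    (integrable_of_abs_le (B := 2) (measurable_nnAvg hv measurable_id fun k l =>
      ((hgk l).sub (hgk k)).abs) fun z => ?_) fun z => ?_
  · refine abs_nnAvg_le_of_abs_le _ zero_le_one fun k l => ?_
    rw [abs_mul]; exact mul_le_one₀ (hg1 _) (abs_nonneg _) (hg1 _)
  · refine abs_nnAvg_le_of_abs_le _ zero_le_two fun k l => ?_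
    rw [abs_abs]
    exact (abs_sub _ _).trans (by linarith [hg1 (v (z k)), hg1 (v (z l))])
  · rw [← nnAvg_left hn (fun l => v (z l)), ← nnAvg_sub]
    refine (abs_nnAvg_le _ _).trans (nnAvg_mono _ fun k l => ?_)
    have e : g (v (z k)) * g (v (z l)) - g (v (z k)) ^ 2
        = g (v (z k)) * (g (v (z l)) - g (v (z k))) := by ring
    rw [e, abs_mul]
    exact mul_le_of_le_one_left (abs_nonneg _) (hg1 _)

/-- The mean of the nearest-neighbour statistic converges. -/
theorem tendsto_integral_nnStat (μ : Measure D) [IsProbabilityMeasure μ] {v : D → E}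
    (hv : Measurable v) {u : D → ℝ} (hu : Measurable u) {g : ℝ → E → ℝ}
    (hg : ∀ y, Measurable (g y)) (hg1 : ∀ y x, |g y x| ≤ 1)
    (hug : ∀ y, ∀ φ : E → ℝ, Measurable φ → (∀ e, |φ e| ≤ 1) →
      ∫ x, upperInd u y x * φ (v x) ∂μ = ∫ x, g y (v x) * φ (v x) ∂μ) :
    StronglyMeasurable (fun y => ∫ x, g y (v x) ^ 2 ∂μ) ∧
    Tendsto (fun n : ℕ => ∫ z : Fin n → D, nnStat (fun l => v (z l)) (fun l => u (z l))
      ∂(Measure.pi fun _ => μ)) atTop (𝓝 (∫ d, ∫ x, g (u d) (v x) ^ 2 ∂μ ∂μ)) := by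
  obtain ⟨K, hK0, hK⟩ := exists_sum_nnWeight_le E
  set J : ℕ → ℝ → ℝ := fun n y => ∫ z : Fin n → D, nnAvg (fun l => v (z l))
    (fun k l => upperInd u y (z k) * upperInd u y (z l)) ∂(Measure.pi fun _ => μ) with hJ
  have hJm : ∀ n, StronglyMeasurable (J n) := fun n =>
    (measurable_nnAvg_upperInd hv hu measurable_fst measurable_snd).stronglyMeasurable.integral_prod_right
  have hJlim : ∀ y, Tendsto (fun n => J n y) atTop (𝓝 (∫ x, g y (v x) ^ 2 ∂μ)) := fun y =>
    tendsto_integral_nnAvg_mul μ hv (measurable_upperInd hu measurable_const measurable_id)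
      (abs_upperInd_le_one u y) (hg _) (hg1 _) (hug _)
  -- The functions `g y` are given separately for each `y`, without joint measurability.
  -- Measurability in `y` of the second moment is inherited from the `J n`, which converge to it
  -- pointwise.
  refine ⟨stronglyMeasurable_of_tendsto atTop hJm (tendsto_pi_nhds.2 hJlim), ?_⟩
  have hJint : Tendsto (fun n => ∫ d, J n (u d) ∂μ) atTop
      (𝓝 (∫ d, ∫ x, g (u d) (v x) ^ 2 ∂μ ∂μ)) := by
    refine tendsto_integral_of_dominated_convergence (fun _ => 1)
      (fun n => ((hJm n).comp_measurable hu).aestronglyMeasurable) (integrable_const _)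
      (fun n => ae_of_all _ fun d => ?_) (ae_of_all _ fun d => hJlim (u d))
    refine (norm_integral_le_of_norm_le_const (ae_of_all _
      fun z => abs_nnAvg_upperInd_le_one _ u (u d) z)).trans ?_
    simp
  have hclose : Tendsto (fun n : ℕ => |∫ z : Fin n → D, nnStat (fun l => v (z l))
      (fun l => u (z l)) ∂(Measure.pi fun _ => μ) - ∫ d, J n (u d) ∂μ|) atTop (𝓝 0) := by
    refine squeeze_zero' (.of_forall fun _ => abs_nonneg _) ?_ (tendsto_const_div_sqrt_atTop (1 + K))
    filter_upwards [eventually_gt_atTop 0] with n hn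
    have := abs_integral_nnStat_sub_le μ hv hu hn hK0 (hK n)
    rwa [← integral_integral_nnAvg_upperInd μ hv hu n] at this
  have := (tendsto_zero_iff_abs_tendsto_zero _).2 hclose
  simpa using this.add hJint

end NeighbourLimits

/-! ### The population coefficient -/

/-- A probability measure on the line whose upper tails have mass zero or one is a point mass. -/
lemma exists_ae_eq_of_tail_zero_or_one (ρ : Measure ℝ) [IsProbabilityMeasure ρ]
    (h : ∀ᵐ y ∂ρ, ρ (Set.Ici y) = 0 ∨ ρ (Set.Ici y) = 1) : ∃ c, ∀ᵐ y ∂ρ, y = c := by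
  -- A point with null upper tail has a null neighbourhood inside this set: if a smaller point
  -- already has null tail, that tail is a neighbourhood; otherwise the point is the least of the
  -- set, and its own tail contains the whole set.
  have h0 : ρ {y | ρ (Set.Ici y) = 0} = 0 := by
    refine measure_null_of_locally_null _ fun y hy => ?_
    by_cases hmin : ∃ y' < y, ρ (Set.Ici y') = 0
    · obtain ⟨y', hlt, hy'⟩ := hmin
      exact ⟨Set.Ici y', mem_nhdsWithin_of_mem_nhds (Ici_mem_nhds hlt), hy'⟩
    · refine ⟨Set.Ici y, mem_nhdsWithin_iff_exists_mem_nhds_inter.2 ⟨Set.univ, univ_mem, ?_⟩, hy⟩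
      rintro x ⟨-, hx⟩
      by_contra hxy
      exact hmin ⟨x, not_le.1 hxy, hx⟩
  have h1 : ∀ᵐ y ∂ρ, ∀ᵐ x ∂ρ, y ≤ x := by
    have h0' : ∀ᵐ y ∂ρ, ρ (Set.Ici y) ≠ 0 := measure_eq_zero_iff_ae_notMem.1 h0
    filter_upwards [h, h0'] with y hy hy0
    exact (prob_compl_eq_zero_iff measurableSet_Ici).2 (hy.resolve_left hy0)
  -- Exchanging the quantifiers yields a single `c` that is both an almost sure lower bound and an
  -- almost sure upper bound.
  have h2 : ∀ᵐ x ∂ρ, ∀ᵐ y ∂ρ, y ≤ x :=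
    (Measure.ae_ae_comm (measurableSet_le measurable_fst measurable_snd)).1 h1
  obtain ⟨c, hc1, hc2⟩ := (h1.and h2).exists
  exact ⟨c, by filter_upwards [hc1, hc2] with y h3 h4 using le_antisymm h4 h3⟩

section Population
variable {Ω D E : Type*} [MeasurableSpace Ω] [MeasurableSpace D]

/-- The tail function of `u`, in terms of the distribution function of `-u`. -/
lemma distFun_neg (μ : Measure D) (u : D → ℝ) (y : ℝ) :
    distFun μ (fun d => -u d) (-y) = ∫ x, upperInd u y x ∂μ := by
  simp only [distFun, neg_le_neg_iff, upperInd]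

/-- This is the denominator of `ξ`. If it vanished, `G * (1 - G)` would be zero almost everywhere,
so almost all upper tails would have mass zero or one and `u` would be almost surely constant. -/
lemma integral_tail_sub_sq_pos (μ : Measure D) [IsProbabilityMeasure μ] {u : D → ℝ}
    (hu : Measurable u) (hnd : ∀ c : ℝ, ¬ ∀ᵐ d ∂μ, u d = c) :
    0 < ∫ d, distFun μ (fun d => -u d) (-u d) ^ 1 ∂μ
      - ∫ d, distFun μ (fun d => -u d) (-u d) ^ 2 ∂μ := by
  set G : D → ℝ := fun d => distFun μ (fun d => -u d) (-u d) with hG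
  have hGm : Measurable G := (measurable_distFun μ hu.neg).comp hu.neg
  have hG0 : ∀ d, 0 ≤ G d := fun d => distFun_nonneg _ _ _
  have hG1 : ∀ d, G d ≤ 1 := fun d => distFun_le_one μ hu.neg _
  have hi : ∀ j, Integrable (fun d => G d ^ j) μ := fun j =>
    integrable_of_abs_le (B := 1) (hGm.pow_const j) fun d => by
      rw [abs_pow, abs_of_nonneg (hG0 d)]; exact pow_le_one₀ (hG0 d) (hG1 d)
  rw [← integral_sub (hi 1) (hi 2)]
  have hnn : ∀ d, 0 ≤ G d ^ 1 - G d ^ 2 := fun d => by nlinarith [hG0 d, hG1 d]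
  refine lt_of_le_of_ne (integral_nonneg hnn) fun h0 => ?_
  have hz := (integral_eq_zero_iff_of_nonneg hnn ((hi 1).sub (hi 2))).1 h0.symm
  have : IsProbabilityMeasure (μ.map u) := Measure.isProbabilityMeasure_map hu.aemeasurable
  have hGr : ∀ d, G d = (μ.map u).real (Set.Ici (u d)) := fun d => by
    rw [hG]
    simp only
    rw [distFun_neg, map_measureReal_apply hu measurableSet_Ici]
    have hm : MeasurableSet (u ⁻¹' Set.Ici (u d)) := hu measurableSet_Ici
    rw [← integral_indicator_one hm]
    refine integral_congr_ae (ae_of_all _ fun x => ?_)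
    by_cases hx : u d ≤ u x <;> simp [upperInd, hx]
  have hset : MeasurableSet {y : ℝ | (μ.map u) (Set.Ici y) = 0 ∨ (μ.map u) (Set.Ici y) = 1} := by
    have hanti : Antitone fun y : ℝ => (μ.map u) (Set.Ici y) := fun a b hab =>
      measure_mono (Set.Ici_subset_Ici.2 hab)
    exact (hanti.measurable (measurableSet_singleton 0)).union
      (hanti.measurable (measurableSet_singleton 1))
  have htail : ∀ᵐ y ∂(μ.map u), (μ.map u) (Set.Ici y) = 0 ∨ (μ.map u) (Set.Ici y) = 1 := by
    rw [ae_map_iff hu.aemeasurable hset]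
    filter_upwards [hz] with d hd
    have h3 : G d * (1 - G d) = 0 := by
      have : G d ^ 1 - G d ^ 2 = 0 := hd
      linarith
    rcases mul_eq_zero.1 h3 with h | h
    · left
      rwa [hGr, measureReal_eq_zero_iff] at h
    · right
      have h4 : (μ.map u).real (Set.Ici (u d)) = 1 := by rw [← hGr]; linarith
      rw [← ofReal_measureReal, h4, ENNReal.ofReal_one]
  obtain ⟨c, hc⟩ := exists_ae_eq_of_tail_zero_or_one _ htail
  exact hnd c (ae_of_ae_map hu.aemeasurable hc)

variable [mE : MeasurableSpace E]

/-- A version of the conditional survival function, as a function of the predictor. -/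
lemma exists_condExp_eq_comp {P : Measure Ω} [IsProbabilityMeasure P] {Z : Ω → D}
    (hZ : Measurable Z) {u : D → ℝ} (hu : Measurable u) {v : D → E} (hv : Measurable v) (y : ℝ) :
    ∃ g : E → ℝ, Measurable g ∧ (∀ x, 0 ≤ g x) ∧ (∀ x, g x ≤ 1) ∧
      P[{ω | y ≤ u (Z ω)}.indicator (fun _ => (1 : ℝ)) | mE.comap fun ω => v (Z ω)]
        =ᵐ[P] (fun ω => g (v (Z ω))) ∧
      ∀ φ : E → ℝ, Measurable φ → (∀ e, |φ e| ≤ 1) →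
        ∫ x, upperInd u y x * φ (v x) ∂(P.map Z)
          = ∫ x, g (v x) * φ (v x) ∂(P.map Z) := by
  set V : Ω → E := fun ω => v (Z ω) with hV
  have hVm : Measurable V := hv.comp hZ
  have hA : MeasurableSet {ω | y ≤ u (Z ω)} := measurableSet_le measurable_const (hu.comp hZ)
  set I : Ω → ℝ := {ω | y ≤ u (Z ω)}.indicator (fun _ => (1 : ℝ)) with hI
  have hIint : Integrable I P := (integrable_const _).indicator hA
  obtain ⟨h, hhm, hh⟩ := (stronglyMeasurable_condExp (f := I) (μ := P)
    (m := mE.comap V)).measurable.exists_eq_measurable_comp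
  have h0 : 0 ≤ᵐ[P] P[I | mE.comap V] :=
    condExp_nonneg (ae_of_all _ fun ω => Set.indicator_nonneg (fun _ _ => zero_le_one) ω)
  have h1 : P[I | mE.comap V] ≤ᵐ[P] fun _ => 1 := by
    have := condExp_mono (m := mE.comap V) hIint (integrable_const (1 : ℝ))
      (ae_of_all P fun ω => Set.indicator_le_self' (fun _ _ => zero_le_one) ω)
    rwa [condExp_const hVm.comap_le] at this
  -- The factor `h` has values in `[0, 1]` only almost surely; clamping makes the bounds hold
  -- everywhere without leaving the almost sure class.
  have hce : P[I | mE.comap V] =ᵐ[P] fun ω => max 0 (min 1 (h (V ω))) := by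
    filter_upwards [h0, h1] with ω h2 h3
    have e : P[I | mE.comap V] ω = h (V ω) := congrFun hh ω
    rw [e] at h2 h3 ⊢
    rw [min_eq_right h3, max_eq_right (show (0 : ℝ) ≤ h (V ω) from h2)]
  refine ⟨fun x => max 0 (min 1 (h x)), measurable_const.max (measurable_const.min hhm),
    fun x => le_max_left _ _, fun x => max_le zero_le_one (min_le_left _ _), hce, ?_⟩
  intro φ hφ hφ1
  have hφV : StronglyMeasurable[mE.comap V] fun ω => φ (V ω) :=
    (hφ.comp (comap_measurable V)).stronglyMeasurable
  have hmul : Integrable (I * fun ω => φ (V ω)) P :=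
    hIint.mul_bdd (c := 1) (hφ.comp hVm).aestronglyMeasurable (ae_of_all _ fun ω => hφ1 _)
  have hpull := condExp_mul_of_stronglyMeasurable_right hφV hmul hIint
  have m1 : Measurable fun x => upperInd u y x * φ (v x) :=
    (measurable_upperInd hu measurable_const measurable_id).mul (hφ.comp hv)
  have m2 : Measurable fun x => max 0 (min 1 (h (v x))) * φ (v x) :=
    (measurable_const.max (measurable_const.min (hhm.comp hv))).mul (hφ.comp hv)
  rw [integral_map hZ.aemeasurable m1.aestronglyMeasurable,
    integral_map hZ.aemeasurable m2.aestronglyMeasurable]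
  calc _ = ∫ ω, (I * fun ω => φ (V ω)) ω ∂P := integral_congr_ae (ae_of_all _ fun ω => by
        simp [hI, Set.indicator_apply, hV, upperInd])
    _ = ∫ ω, (P[I * (fun ω => φ (V ω)) | mE.comap V]) ω ∂P := (integral_condExp hVm.comap_le).symm
    _ = _ := integral_congr_ae (by
      filter_upwards [hpull, hce] with ω h2 h3
      rw [h2, Pi.mul_apply, h3])

lemma variance_eq_integral_sq_sub {P : Measure Ω} [IsProbabilityMeasure P] {f : Ω → ℝ}
    (hf : AEStronglyMeasurable f P) (h1 : ∀ᵐ ω ∂P, |f ω| ≤ 1) :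
    variance f P = ∫ ω, f ω ^ 2 ∂P - (∫ ω, f ω ∂P) ^ 2 := by
  rw [variance_eq_sub (MemLp.of_bound hf 1 h1)]
  rfl

/-- The coefficient in terms of a version of the conditional survival function. -/
lemma acXi_eq {P : Measure Ω} [IsProbabilityMeasure P] {Z : Ω → D}
    (hZ : Measurable Z) {u : D → ℝ} (hu : Measurable u) {v : D → E} (hv : Measurable v)
    {g : ℝ → E → ℝ} (hg : ∀ y, Measurable (g y)) (hg0 : ∀ y x, 0 ≤ g y x) (hg1 : ∀ y x, g y x ≤ 1)
    (hce : ∀ y, P[{ω | y ≤ u (Z ω)}.indicator (fun _ => (1 : ℝ)) | mE.comap fun ω => v (Z ω)]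
        =ᵐ[P] (fun ω => g y (v (Z ω))))
    (hmean : ∀ y, ∫ x, upperInd u y x ∂(P.map Z) = ∫ x, g y (v x) ∂(P.map Z))
    (hmeas : StronglyMeasurable fun y => ∫ x, g y (v x) ^ 2 ∂(P.map Z)) :
    acXi P (fun ω => u (Z ω)) (fun ω => v (Z ω)) =
      (∫ d, ∫ x, g (u d) (v x) ^ 2 ∂(P.map Z) ∂(P.map Z)
        - ∫ d, distFun (P.map Z) (fun d => -u d) (-u d) ^ 2 ∂(P.map Z)) /
      (∫ d, distFun (P.map Z) (fun d => -u d) (-u d) ^ 1 ∂(P.map Z)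
        - ∫ d, distFun (P.map Z) (fun d => -u d) (-u d) ^ 2 ∂(P.map Z)) := by
  set μ := P.map Z with hμ
  have : IsProbabilityMeasure μ := Measure.isProbabilityMeasure_map hZ.aemeasurable
  set G : ℝ → ℝ := fun y => distFun μ (fun d => -u d) (-y) with hG
  have hGm : Measurable G := (measurable_distFun μ hu.neg).comp measurable_neg
  have hG0 : ∀ y, 0 ≤ G y := fun d => distFun_nonneg _ _ _
  have hG1 : ∀ y, G y ≤ 1 := fun d => distFun_le_one μ hu.neg _
  have hGi : ∀ j, Integrable (fun d => G (u d) ^ j) μ := fun j =>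
    integrable_of_abs_le (B := 1) ((hGm.comp hu).pow_const j) fun d => by
      rw [abs_pow, abs_of_nonneg (hG0 _)]; exact pow_le_one₀ (hG0 _) (hG1 _)
  have hmap : P.map (fun ω => u (Z ω)) = μ.map u := (Measure.map_map hu hZ).symm
  have hsq1 : ∀ y x, |g y (v x) ^ 2| ≤ 1 := fun y x => by
    rw [abs_pow, abs_of_nonneg (hg0 _ _)]; exact pow_le_one₀ (hg0 _ _) (hg1 _ _)
  have hnum : ∀ y, variance (P[{ω | y ≤ u (Z ω)}.indicator (fun _ => (1 : ℝ)) |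
      mE.comap fun ω => v (Z ω)]) P = ∫ x, g y (v x) ^ 2 ∂μ - G y ^ 2 := by
    intro y
    have hm : Measurable fun ω => g y (v (Z ω)) := (hg y).comp (hv.comp hZ)
    rw [variance_congr (hce y), variance_eq_integral_sq_sub hm.aestronglyMeasurable
      (ae_of_all _ fun ω => by rw [abs_of_nonneg (hg0 _ _)]; exact hg1 _ _), hG]
    simp only
    have m1 : Measurable fun x => g y (v x) := (hg y).comp hv
    have m2 : Measurable fun x => g y (v x) ^ 2 := m1.pow_const 2
    rw [distFun_neg, hmean, hμ, integral_map hZ.aemeasurable m2.aestronglyMeasurable,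
      integral_map hZ.aemeasurable m1.aestronglyMeasurable]
  have hden : ∀ y, variance ({ω | y ≤ u (Z ω)}.indicator (fun _ => (1 : ℝ))) P
      = G y ^ 1 - G y ^ 2 := by
    intro y
    have hA : MeasurableSet {ω | y ≤ u (Z ω)} := measurableSet_le measurable_const (hu.comp hZ)
    have hm : Measurable ({ω | y ≤ u (Z ω)}.indicator (fun _ => (1 : ℝ))) :=
      measurable_const.indicator hA
    have m1 : Measurable (upperInd u y) := measurable_upperInd hu measurable_const measurable_id
    rw [variance_eq_integral_sq_sub hm.aestronglyMeasurable (ae_of_all _ fun ω => by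
      rw [Set.indicator_apply]; split_ifs <;> norm_num), hG]
    simp only
    rw [distFun_neg, hμ, integral_map hZ.aemeasurable m1.aestronglyMeasurable, pow_one]
    have e1 : ∀ ω, {ω | y ≤ u (Z ω)}.indicator (fun _ => (1 : ℝ)) ω ^ 2
        = upperInd u y (Z ω) := fun ω => by
      simp [Set.indicator_apply, upperInd]
    have e2 : ∀ ω, {ω | y ≤ u (Z ω)}.indicator (fun _ => (1 : ℝ)) ω
        = upperInd u y (Z ω) := fun ω => by
      simp [Set.indicator_apply, upperInd]
    simp_rw [e1]
    simp_rw [e2]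
  unfold acXi
  simp_rw [hnum, hden]
  have m1 : Measurable fun y => ∫ x, g y (v x) ^ 2 ∂μ - G y ^ 2 :=
    hmeas.measurable.sub (hGm.pow_const 2)
  have m2 : Measurable fun y => G y ^ 1 - G y ^ 2 := (hGm.pow_const 1).sub (hGm.pow_const 2)
  rw [hmap, integral_map hu.aemeasurable m1.aestronglyMeasurable,
    integral_map hu.aemeasurable m2.aestronglyMeasurable]
  have hLi : Integrable (fun d => ∫ x, g (u d) (v x) ^ 2 ∂μ) μ := by
    refine integrable_of_abs_le (B := 1) (hmeas.measurable.comp hu) fun d => ?_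
    have hn : ∀ x, ‖g (u d) (v x) ^ 2‖ ≤ 1 := hsq1 (u d)
    refine (norm_integral_le_of_norm_le_const (ae_of_all _ hn)).trans ?_
    simp
  rw [← integral_sub hLi (hGi 2), ← integral_sub (hGi 1) (hGi 2)]

end Population

/-! ### Consistency of the estimator -/

/-- Numerator and denominator both carry a factor `n ^ 3`: two powers from normalising the ranks and
one from averaging. Adding and subtracting the tie-averaged row means separates the random selection
from the sample; the predictors `v` enter only through this splitting and cancel. -/
lemma acXiN_eq {E : Type*} [PseudoMetricSpace E] {n : ℕ} (hn : 0 < n) (v : Fin n → E)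
    (y : Fin n → ℝ) (N : Fin n → Fin n) :
    acXiN y N = (nnDeviation v (fun k l => ecdf y (min (y k) (y l))) N + nnStat v y
        - rankStat 2 (fun l => -y l)) /
      (rankStat 1 (fun l => -y l) - rankStat 2 (fun l => -y l)) := by
  have hn' : (n : ℝ) ≠ 0 := by exact_mod_cast hn.ne'
  have hR : ∀ k l, min (rankLE y k : ℝ) (rankLE y l : ℝ) = n * ecdf y (min (y k) (y l)) :=
    fun k l => by rw [← min_rankLE_div]; field_simp
  have hL : ∀ k, (rankGE y k : ℝ) = n * ecdf (fun l => -y l) (-y k) := fun k => by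
    rw [← rankGE_div]; field_simp
  have hnum : ∑ k, ((n : ℝ) * min (rankLE y k : ℝ) (rankLE y (N k) : ℝ) - (rankGE y k : ℝ) ^ 2)
      = (n : ℝ) ^ 3 * (nnDeviation v (fun k l => ecdf y (min (y k) (y l))) N + nnStat v y
        - rankStat 2 (fun l => -y l)) := by
    rw [nnDeviation, nnStat, rankStat, ← add_div, ← sub_div, ← Finset.sum_add_distrib,
      ← Finset.sum_sub_distrib, ← mul_div_assoc, eq_div_iff hn', Finset.mul_sum, Finset.sum_mul]
    refine Finset.sum_congr rfl fun k _ => ?_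
    rw [hR, hL]; ring
  have hden : ∑ k, (rankGE y k : ℝ) * ((n : ℝ) - (rankGE y k : ℝ))
      = (n : ℝ) ^ 3 * (rankStat 1 (fun l => -y l) - rankStat 2 (fun l => -y l)) := by
    rw [rankStat, rankStat, ← sub_div, ← Finset.sum_sub_distrib, ← mul_div_assoc,
      eq_div_iff hn', Finset.mul_sum, Finset.sum_mul]
    refine Finset.sum_congr rfl fun k _ => ?_
    rw [hL]; ring
  rw [acXiN, hnum, hden, mul_div_mul_left _ _ (pow_ne_zero 3 hn')]

section Consistency
variable {Ω D E : Type*} [MeasurableSpace Ω] [MeasurableSpace D]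
  [NormedAddCommGroup E] [ProperSpace E] [MeasurableSpace E] [BorelSpace E]
  {P : Measure Ω} [IsProbabilityMeasure P]

lemma ae_tendsto_nnDeviation {Z : ℕ → Ω → D} (hZ : ∀ l, Measurable (Z l)) {u : D → ℝ}
    (hu : Measurable u) {v : D → E} (hv : Measurable v) {N : ∀ n, Fin n → Ω → Fin n}
    (hN : ∀ n, 2 ≤ n → IsRandomNN P (fun (l : Fin n) ω => Z l ω) v (N n)) :
    ∀ᵐ ω ∂P, Tendsto (fun n : ℕ => nnDeviation (fun l : Fin n => v (Z l ω))
      (fun k l => ecdf (fun i : Fin n => u (Z i ω)) (min (u (Z k ω)) (u (Z l ω))))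
      (fun k => N n k ω)) atTop (𝓝 0) := by
  have hu' : ∀ n, ∀ l : Fin n, Measurable fun z : Fin n → D => u (z l) := fun n l =>
    hu.comp (measurable_pi_apply l)
  have key : ∀ n, 2 ≤ n → ∀ t : ℝ, _ := fun n hn t =>
    integrable_and_integral_exp_nnDeviation_le hn (fun l : Fin n => hZ l) (hN n hn)
      (H := fun z k l => ecdf (fun i => u (z i)) (min (u (z k)) (u (z l))))
      (fun k l => measurable_ecdf (hu' n) ((hu' n k).min (hu' n l)))
      (fun k l => (measurable_nnWeight k l).comp
        (measurable_pi_lambda _ fun i => hv.comp (measurable_pi_apply i)))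
      (fun _ _ _ => ecdf_nonneg _ _) (fun _ _ _ => ecdf_le_one _ _) t
  refine ae_tendsto_zero_of_subgaussian one_pos (fun n hn t => (key n hn t).1) fun n hn t => ?_
  rw [one_mul]
  exact (key n hn t).2

variable [NormedSpace ℝ E]

lemma ae_tendsto_nnStat_sub {Z : ℕ → Ω → D} (hZ : ∀ l, Measurable (Z l)) (hind : iIndepFun Z P)
    {μ : Measure D} [IsProbabilityMeasure μ] (hlaw : ∀ l, P.map (Z l) = μ) {u : D → ℝ}
    (hu : Measurable u) {v : D → E} (hv : Measurable v) :
    ∀ᵐ ω ∂P, Tendsto (fun n : ℕ => nnStat (fun l : Fin n => v (Z l ω)) (fun l => u (Z l ω))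
      - ∫ z : Fin n → D, nnStat (fun l => v (z l)) (fun l => u (z l)) ∂(Measure.pi fun _ => μ))
      atTop (𝓝 0) := by
  obtain ⟨K, hK0, hK⟩ := exists_sum_nnWeight_le E
  refine ae_tendsto_sub_integral hZ hind hlaw
    (f := fun n z => nnStat (fun l => v (z l)) (fun l => u (z l))) (fun n => measurable_nnStat hv hu)
    (B := 1) (C := 2 * K + 2) (fun n z => ?_) (by positivity) fun n z i x => ?_
  · rw [abs_of_nonneg (nnStat_nonneg _ _)]; exact nnStat_le_one _ _
  · exact abs_nnStat_sub_le (hK n) (fun l hl => by rw [Function.update_of_ne hl])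
      (fun l hl => by rw [Function.update_of_ne hl])

lemma ae_tendsto_rankStat {Z : ℕ → Ω → D} (hZ : ∀ l, Measurable (Z l)) (hind : iIndepFun Z P)
    {μ : Measure D} [IsProbabilityMeasure μ] (hlaw : ∀ l, P.map (Z l) = μ) {u : D → ℝ}
    (hu : Measurable u) (j : ℕ) :
    ∀ᵐ ω ∂P, Tendsto (fun n : ℕ => rankStat j (fun l : Fin n => u (Z l ω)))
      atTop (𝓝 (∫ x, distFun μ u (u x) ^ j ∂μ)) := by
  have := ae_tendsto_sub_integral hZ hind hlaw
    (f := fun n z => rankStat j (fun l => u (z l))) (fun n => measurable_rankStat j hu)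
    (B := 1) (C := j + 1) (fun n z => by
      rw [abs_of_nonneg (rankStat_nonneg _ _)]; exact rankStat_le_one _ _) (by positivity)
    fun n z i x => abs_rankStat_sub_le j (fun l hl => by rw [Function.update_of_ne hl])
  filter_upwards [this] with ω hω
  simpa using hω.add (tendsto_integral_rankStat j μ hu)

/-- Strong consistency of the estimator `ξ_n`, and the upper bound of its limit. -/
theorem acXi_le_one_and_ae_tendsto_acXiN {Z₀ : Ω → D} (hZ₀ : Measurable Z₀)
    {Z : ℕ → Ω → D} (hZ : ∀ l, Measurable (Z l)) (hind : iIndepFun Z P)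
    (hlaw : ∀ l, P.map (Z l) = P.map Z₀) {u : D → ℝ} (hu : Measurable u)
    (hnd : ∀ c : ℝ, ¬ ∀ᵐ ω ∂P, u (Z₀ ω) = c) {v : D → E} (hv : Measurable v) :
    acXi P (fun ω => u (Z₀ ω)) (fun ω => v (Z₀ ω)) ≤ 1 ∧
    ∀ N : ∀ n, Fin n → Ω → Fin n,
      (∀ n, 2 ≤ n → IsRandomNN P (fun (l : Fin n) ω => Z l ω) v (N n)) →
      ∀ᵐ ω ∂P, Tendsto (fun n : ℕ => acXiN (fun l : Fin n => u (Z l ω)) (fun k => N n k ω)) atTop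
        (𝓝 (acXi P (fun ω => u (Z₀ ω)) (fun ω => v (Z₀ ω)))) := by
  set μ := P.map Z₀ with hμ
  have : IsProbabilityMeasure μ := Measure.isProbabilityMeasure_map hZ₀.aemeasurable
  choose g hg hg0 hg1 hce hug using fun y => exists_condExp_eq_comp (P := P) hZ₀ hu hv y
  have habs : ∀ y x, |g y x| ≤ 1 := fun y x => by
    rw [abs_of_nonneg (hg0 y x)]; exact hg1 y x
  obtain ⟨hmeas, hlim⟩ := tendsto_integral_nnStat μ hv hu hg habs hug
  have hmean : ∀ y, ∫ x, upperInd u y x ∂μ = ∫ x, g y (v x) ∂μ := fun y => by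
    simpa using hug y (fun _ => 1) measurable_const (by simp)
  have hpos := integral_tail_sub_sq_pos μ hu fun c hc => hnd c (ae_of_ae_map hZ₀.aemeasurable hc)
  rw [acXi_eq hZ₀ hu hv hg hg0 hg1 hce hmean hmeas]
  refine ⟨?_, fun N hN => ?_⟩
  -- Since `0 ≤ g ≤ 1`, one has `g ^ 2 ≤ g`, and the mean of `g y` is the upper tail at `y`.
  · refine div_le_one_of_le₀ (sub_le_sub_right ?_ _) hpos.le
    have hm : Measurable fun d => distFun μ (fun d => -u d) (-u d) ^ 1 :=
      ((measurable_distFun μ hu.neg).comp hu.neg).pow_const 1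
    refine integral_mono_of_nonneg (ae_of_all _ fun d => integral_nonneg fun x => sq_nonneg _)
      (integrable_of_abs_le (B := 1) hm fun d => ?_) (ae_of_all _ fun d => ?_)
    · rw [pow_one, abs_of_nonneg (distFun_nonneg _ _ _)]
      exact distFun_le_one μ hu.neg _
    · simp only [pow_one]
      rw [distFun_neg, hmean]
      have hgv : Measurable fun x => g (u d) (v x) := (hg _).comp hv
      refine integral_mono_of_nonneg (ae_of_all _ fun x => sq_nonneg _)
        (integrable_of_abs_le hgv fun x => habs _ _) (ae_of_all _ fun x => ?_)
      simp only
      nlinarith [hg0 (u d) (v x), hg1 (u d) (v x)]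
  · filter_upwards [ae_tendsto_nnDeviation hZ hu hv hN, ae_tendsto_nnStat_sub hZ hind hlaw hu hv,
      ae_tendsto_rankStat hZ hind hlaw hu.neg 1, ae_tendsto_rankStat hZ hind hlaw hu.neg 2]
      with ω h1 h2 h3 h4
    have h5 := h2.add hlim
    simp only [sub_add_cancel, zero_add] at h5
    have h6 := ((h1.add h5).sub h4).div (h3.sub h4) hpos.ne'
    rw [zero_add] at h6
    refine h6.congr' ?_
    filter_upwards [eventually_gt_atTop 0] with n hn
    exact (acXiN_eq hn (fun l : Fin n => v (Z l ω)) (fun l => u (Z l ω)) (fun k => N n k ω)).symm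

end Consistency

/-! ### The measure of predictability -/

section Predictability
variable {Ω : Type*} [MeasurableSpace Ω] {P : Measure Ω} [IsProbabilityMeasure P] {p q : ℕ}

lemma measurable_euclidean_apply {ι : Type*} [Fintype ι] (i : ι) :
    Measurable fun y : EuclideanSpace ℝ ι => y i :=
  (PiLp.continuous_apply 2 _ i).measurable

lemma measurable_prevXY (i : Fin q) : Measurable (prevXY (p := p) i) := by
  refine (PiLp.continuous_toLp 2 _).measurable.comp (measurable_pi_lambda _ fun j => ?_)
  rcases j with a | j
  · exact (measurable_euclidean_apply a).comp measurable_fst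
  · exact (measurable_euclidean_apply j.1).comp measurable_snd

lemma measurable_prevY (i : Fin q) : Measurable (prevY i) :=
  (PiLp.continuous_toLp 2 _).measurable.comp (measurable_pi_lambda _ fun j =>
    measurable_euclidean_apply j.1)

lemma measurable_permVec (σ : Equiv.Perm (Fin q)) : Measurable (permVec σ) :=
  (PiLp.continuous_toLp 2 _).measurable.comp (measurable_pi_lambda _ fun j =>
    measurable_euclidean_apply (σ j))

/-- Strong consistency of the estimator `T_n`. -/
theorem ae_tendsto_predTN (hq : 1 ≤ q)
    {X : Ω → EuclideanSpace ℝ (Fin p)} {Y : Ω → EuclideanSpace ℝ (Fin q)}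
    (hX : Measurable X) (hY : Measurable Y)
    (hnd : ∀ (i : Fin q) (c : ℝ), ¬ (∀ᵐ ω ∂P, Y ω i = c))
    {Xs : ℕ → Ω → EuclideanSpace ℝ (Fin p)} {Ys : ℕ → Ω → EuclideanSpace ℝ (Fin q)}
    (hXs : ∀ l, Measurable (Xs l)) (hYs : ∀ l, Measurable (Ys l))
    (hindep : iIndepFun (fun l ω => (Xs l ω, Ys l ω)) P)
    (hident : ∀ l, IdentDistrib (fun ω => (Xs l ω, Ys l ω)) (fun ω => (X ω, Y ω)) P P)
    {N M : Fin q → (n : ℕ) → Fin n → Ω → Fin n} (hNM : IsRandomNNFamily P Xs Ys N M) :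
    ∀ᵐ ω ∂P, Tendsto
      (fun n : ℕ => predTN (fun l : Fin n => Ys l ω) (fun i k => N i n k ω) (fun i k => M i n k ω))
      atTop (𝓝 (predT P X Y)) := by
  have hZ₀ : Measurable fun ω => (X ω, Y ω) := hX.prodMk hY
  have hZ : ∀ l, Measurable fun ω => (Xs l ω, Ys l ω) := fun l => (hXs l).prodMk (hYs l)
  have hlaw := fun l => (hident l).map_eq
  have hu : ∀ i, Measurable fun z : EuclideanSpace ℝ (Fin p) × EuclideanSpace ℝ (Fin q) => z.2 i :=
    fun i => (measurable_euclidean_apply i).comp measurable_snd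
  have hA := fun i => (acXi_le_one_and_ae_tendsto_acXiN hZ₀ hZ hindep hlaw (hu i) (hnd i)
    (measurable_prevXY i)).2 (N i) (hNM.joint i)
  have hB := fun i => acXi_le_one_and_ae_tendsto_acXiN hZ₀ hZ hindep hlaw (hu i) (hnd i)
    ((measurable_prevY i).comp measurable_snd)
  have hB' : ∀ᵐ ω ∂P, ∀ i : Fin q, 0 < i.val → Tendsto
      (fun n : ℕ => acXiN (fun l : Fin n => Ys l ω i) (fun k => M i n k ω)) atTop
      (𝓝 (acXi P (fun ω => Y ω i) (fun ω => prevY i (Y ω)))) :=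
    ae_all_iff.2 fun i => by
      by_cases hi : 0 < i.val
      · filter_upwards [(hB i).2 (M i) (hNM.prev i hi)] with ω hω _ using hω
      · exact ae_of_all _ fun ω h => absurd h hi
  have hprev : ∑ i with 0 < i.val, acXi P (fun ω => Y ω i) (fun ω => prevY i (Y ω))
      = ∑ i, acXiPrev P Y i := by
    rw [Finset.sum_filter]
    refine Finset.sum_congr rfl fun i _ => ?_
    unfold acXiPrev
    by_cases hi : i.val = 0
    · simp [hi]
    · simp [hi, Nat.pos_of_ne_zero hi]
  have hle : ∀ i, acXiPrev P Y i ≤ 1 := fun i => by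
    unfold acXiPrev
    split_ifs
    · exact zero_le_one
    · exact (hB i).1
  -- All terms `1 - ξ` are nonnegative, and the convention `ξ(Y_1 | ∅) = 0` makes the first one
  -- equal to `1`. Here `1 ≤ q` is needed.
  have hpos : 0 < (q : ℝ) - ∑ i, acXiPrev P Y i := by
    have e : (q : ℝ) - ∑ i, acXiPrev P Y i = ∑ i, (1 - acXiPrev P Y i) := by
      simp [Finset.sum_sub_distrib]
    rw [e]
    refine Finset.sum_pos' (fun i _ => sub_nonneg.2 (hle i)) ⟨⟨0, hq⟩, Finset.mem_univ _, ?_⟩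
    simp [acXiPrev]
  have hT : predT P X Y = 1 - ((q : ℝ) -
      ∑ i, acXi P (fun ω => Y ω i) (fun ω => prevXY i (X ω, Y ω))) /
      ((q : ℝ) - ∑ i, acXiPrev P Y i) := by
    unfold predT
    rw [Finset.sum_sub_distrib, Finset.sum_sub_distrib]
    simp only [Finset.sum_const, Finset.card_univ, Fintype.card_fin, nsmul_eq_mul, mul_one]
    rw [eq_sub_iff_add_eq, ← add_div, div_eq_one_iff_eq hpos.ne']
    ring
  rw [hT]
  filter_upwards [ae_all_iff.2 hA, hB'] with ω h1 h2
  refine (((tendsto_finsetSum _ fun i _ => h1 i).const_sub (q : ℝ)).div ?_ hpos.ne').const_sub 1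
  rw [← hprev]
  exact (tendsto_finsetSum _ fun i hi => h2 i (Finset.mem_filter.1 hi).2).const_sub _

end Predictability

theorem mainTheorem9 {Ω : Type*} [MeasurableSpace Ω] (P : Measure Ω) [IsProbabilityMeasure P]
    (p q : ℕ) (hp : 1 ≤ p) (hq : 1 ≤ q)
    (X : Ω → EuclideanSpace ℝ (Fin p)) (Y : Ω → EuclideanSpace ℝ (Fin q))
    (hX : Measurable X) (hY : Measurable Y)
    (hnd : ∀ (i : Fin q) (c : ℝ), ¬ (∀ᵐ ω ∂P, Y ω i = c))
    (Xs : ℕ → Ω → EuclideanSpace ℝ (Fin p)) (Ys : ℕ → Ω → EuclideanSpace ℝ (Fin q))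
    (hXs : ∀ l, Measurable (Xs l)) (hYs : ∀ l, Measurable (Ys l))
    (hindep : iIndepFun (fun l ω => (Xs l ω, Ys l ω)) P)
    (hident : ∀ l, IdentDistrib (fun ω => (Xs l ω, Ys l ω)) (fun ω => (X ω, Y ω)) P P) :
    (∀ N M : Fin q → (n : ℕ) → Fin n → Ω → Fin n,
      IsRandomNNFamily P Xs Ys N M →
      ∀ᵐ ω ∂P, Tendsto
        (fun n : ℕ => predTN (fun l : Fin n => Ys l ω)
          (fun i k => N i n k ω) (fun i k => M i n k ω))
        atTop (𝓝 (predT P X Y))) ∧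
    (∀ N M : Equiv.Perm (Fin q) → Fin q → (n : ℕ) → Fin n → Ω → Fin n,
      (∀ σ, IsRandomNNFamily P Xs (fun l ω => permVec σ (Ys l ω)) (N σ) (M σ)) →
      ∀ᵐ ω ∂P, Tendsto
        (fun n : ℕ => predTbarN (fun l : Fin n => Ys l ω)
          (fun σ i k => N σ i n k ω) (fun σ i k => M σ i n k ω))
        atTop (𝓝 (predTbar P X Y))) := by
  refine ⟨fun N M h => ae_tendsto_predTN hq hX hY hnd hXs hYs hindep hident h, fun N M h => ?_⟩
  have hσ : ∀ σ : Equiv.Perm (Fin q), ∀ᵐ ω ∂P, Tendsto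
      (fun n : ℕ => predTN (fun l : Fin n => permVec σ (Ys l ω))
        (fun i k => N σ i n k ω) (fun i k => M σ i n k ω))
      atTop (𝓝 (predT P X fun ω => permVec σ (Y ω))) := by
    intro σ
    have hm := measurable_permVec σ
    have hpm : Measurable (Prod.map id (permVec σ) :
        EuclideanSpace ℝ (Fin p) × EuclideanSpace ℝ (Fin q) → _) := measurable_id.prodMap hm
    -- Permuting the response components is a measurable map applied to every observation, so
    -- independence and identical distribution persist, and component `i` is non-degenerate because
    -- component `σ i` was.
    exact ae_tendsto_predTN hq hX (hm.comp hY) (fun i c => hnd (σ i) c) hXs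
      (fun l => hm.comp (hYs l)) (hindep.comp (fun _ => Prod.map id (permVec σ)) fun _ => hpm)
      (fun l => (hident l).comp hpm) (h σ)
  filter_upwards [ae_all_iff.2 hσ] with ω hω
  exact (tendsto_finsetSum _ fun σ _ => hω σ).const_mul _
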